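/- Let $\mathcal T=(\mathcal V,\mathcal E)$ be a tree, possibly infinite, rooted at $r\in\mathcal V$, and write $\mathrm{pa}(v)$ for the parent of $v\neq r$. Let $\lambda_v>0$ $(v\in\mathcal V)$ and let $\alpha_e$ $(e\in\mathcal E)$ satisfy $0<\alpha_{(\mathrm{pa}(v),v)}\le\min\big(\sqrt{\lambda_v/\lambda_{\mathrm{pa}(v)}},\sqrt{\lambda_{\mathrm{pa}(v)}/\lambda_v}\big)$. Say that a family of $\mathbb N$-valued random variables $\boldsymbol N=(N_v)_{v\in\mathcal V}$ is $\mathrm{MPMRF}(\boldsymbol\lambda,\boldsymbol\alpha,\mathcal T_r)$ if it has the joint distribution of the family given by $N_r=L_r$ and $$N_v=\theta_v\circ N_{\mathrm{pa}(v)}+L_v\quad(v\ne r),\qquad \theta_v=\alpha_{(\mathrm{pa}(v),v)}\sqrt{\lambda_v/\lambda_{\mathrm{pa}(v)}},$$ where $L_r\sim\mathrm{Poisson}(\lambda_r)$, $L_v\sim\mathrm{Poisson}\big(\lambda_v-\alpha_{(\mathrm{pa}(v),v)}\sqrt{\lambda_{\mathrm{pa}(v)}\lambda_v}\big)$ for $v\ne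 r$ (with $\mathrm{Poisson}(0)$ the point mass at $0$), $\theta_v\circ Y=\sum_{j=1}^{Y}I_{v,j}$ with $I_{v,j}\sim\mathrm{Bernoulli}(\theta_v)$, and all the variables $L_v$ and $I_{v,j}$ are independent. For $\chi\ge2$ let $\mathcal B^{(\chi)}$ be the Bethe lattice of degree $\chi$, i.e. the infinite tree in which every vertex has exactly $\chi$ neighbours. Fix $\lambda_r>0$ and $\theta\in(0,1)$. For each $n\in\mathbb N$ let $\chi_n\ge 2$ be an integer, let $\alpha_n\in(0,1]$, and let $\boldsymbol N^{(n)}\sim\mathrm{MPMRF}(\boldsymbol\lambda^{(n)},\boldsymbol\alpha^{(n)},\mathcal B_r^{(\chi_n)})$, where $\alpha^{(n)}_e=\alpha_n$ for every edge $e$, the root has mean parameter $\lambda^{(n)}_r=\lambda_r$, and $\lambda^{(n)}_v=\lambda^{(n)}_{\mathrm{pa}(v)}\alpha_n^2$ for every $v\neq r$. Let $M_n=\sum_{v}N^{(n)}_v\in[0,\infty]$. Suppose that $\chi_n\to\infty$ and $\chi_n\alpha_n^2\to\theta$ as $n\to\infty$. Then $M_n$ converges in distribution to the generalized Poisson distribution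 with parameters $\lambda_r$ and $\theta$: the function $$p(x)=\frac{\lambda_r(\lambda_r+x\theta)^{x-1}}{x!}\,e^{-\lambda_r-x\theta},\qquad x\in\mathbb N,$$ is a probability mass function on $\mathbb N$, the law of $M_n$ converges weakly to the distribution with pmf $p$, and $\Pr(M_n=x)\to p(x)$ for every $x\in\mathbb N$. -/

import Mathlib

open MeasureTheory ProbabilityTheory Filter Topology
open scoped ENNReal

universe u

/-- In the rooted version of the tree `G` with root `r`, the vertex `p` is the parent of `v`:
it is the neighbour of `v` on the path from `v` to `r`. -/
def IsParent {V : Type u} (G : SimpleGraph V) (r p v : V) : Prop :=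
  G.Adj p v ∧ G.dist r v = G.dist r p + 1

/-- The Bethe lattice of degree `χ`: the infinite tree (`χ ≥ 2`) in which every vertex has exactly
`χ` neighbours. -/
structure IsBetheLattice {V : Type u} (G : SimpleGraph V) (χ : ℕ) : Prop where
  isTree : G.IsTree
  two_le : 2 ≤ χ
  ncard_neighborSet : ∀ v : V, (G.neighborSet v).ncard = χ

/-- Binomial thinning `θ ∘ Y = ∑_{j < Y} I j`, where the `I j` are the Bernoulli(`θ`) variables that
carry out the thinning. -/
def binomialThinning {Ω : Type*} (I : ℕ → Ω → ℕ) (Y : Ω → ℕ) (ω : Ω) : ℕ :=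
  ∑ j ∈ Finset.range (Y ω), I j ω

/-- The mean parameters `lam` and the dependence parameters `alpha` (a function of the edges) are
admissible: `lam v > 0` for every vertex, and
`0 < alpha (pa(v), v) ≤ min (√(lam v / lam pa(v))) (√(lam pa(v) / lam v))` for every edge. -/
def Admissible {V : Type u} (G : SimpleGraph V) (lam : V → ℝ) (alpha : Sym2 V → ℝ) : Prop :=
  (∀ v, 0 < lam v) ∧
    ∀ p v, G.Adj p v →
      0 < alpha s(p, v) ∧
        alpha s(p, v) ≤ min (√(lam v / lam p)) (√(lam p / lam v))

/-- The stochastic construction of a tree-structured Markov random field with Poisson marginals.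
The innovations `L v` and the Bernoulli variables `I v j` are all independent; `L r` is
Poisson(`lam r`) and `N r = L r`; and for a vertex `v` with parent `p`, `L v` is
Poisson(`lam v - alpha (p, v) √(lam p * lam v)`), where Poisson(`0`) is the point mass at `0`, the
`I v j` are Bernoulli(`θ v`) with `θ v = alpha (p, v) √(lam v / lam p)`, and
`N v = θ v ∘ N p + L v`. -/
structure IsPoissonTreeConstruction {V : Type u} (G : SimpleGraph V) (r : V) (lam : V → ℝ)
    (alpha : Sym2 V → ℝ) {Ω : Type*} [MeasurableSpace Ω] (P : Measure Ω)
    (L : V → Ω → ℕ) (I : V → ℕ → Ω → ℕ) (N : V → Ω → ℕ) : Prop where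
  measurable_L : ∀ v, Measurable (L v)
  measurable_I : ∀ v j, Measurable (I v j)
  iIndepFun : iIndepFun (Sum.elim L (fun p : V × ℕ => I p.1 p.2)) P
  law_root : HasLaw (L r) (poissonMeasure (lam r).toNNReal) P
  law_innovation : ∀ p v, IsParent G r p v →
    HasLaw (L v) (poissonMeasure (lam v - alpha s(p, v) * √(lam p * lam v)).toNNReal) P
  law_thinning : ∀ p v, IsParent G r p v → ∀ j, ∃ θ : unitInterval,
    (θ : ℝ) = alpha s(p, v) * √(lam v / lam p) ∧ HasLaw (I v j) (bernoulliMeasure 1 0 θ) P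
  eq_root : ∀ ω, N r ω = L r ω
  eq_child : ∀ p v, IsParent G r p v → ∀ ω, N v ω = binomialThinning (I v) (N p) ω + L v ω

/-- `N ∼ MPMRF(lam, alpha, G_r)` under `P`: the parameters are admissible, and `N` has the joint
distribution of a family produced by the stochastic construction rooted at `r`, on some probability
space. -/
def IsMPMRF {V : Type u} (G : SimpleGraph V) (r : V) (lam : V → ℝ) (alpha : Sym2 V → ℝ)
    {Ω : Type*} [MeasurableSpace Ω] (P : Measure Ω) (N : V → Ω → ℕ) : Prop :=
  Admissible G lam alpha ∧
    ∃ (Ω' : Type u) (_ : MeasurableSpace Ω') (P' : Measure Ω')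
      (L : V → Ω' → ℕ) (I : V → ℕ → Ω' → ℕ) (N' : V → Ω' → ℕ),
      IsProbabilityMeasure P' ∧
      IsPoissonTreeConstruction G r lam alpha P' L I N' ∧
      IdentDistrib (fun ω v => N v ω) (fun ω v => N' v ω) P P'

/-- The splash condition on the mean parameters: `lam v = lam pa(v) * alpha (pa(v), v) ^ 2`
for every vertex `v` other than the root. -/
def IsSplash {V : Type u} (G : SimpleGraph V) (r : V) (lam : V → ℝ) (alpha : Sym2 V → ℝ) : Prop :=
  ∀ p v, IsParent G r p v → lam v = lam p * alpha s(p, v) ^ 2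

/-- The total count `M = ∑_v N v`, with values in `[0, ∞]`. -/
noncomputable def totalCount {V : Type u} {Ω : Type*} (N : V → Ω → ℕ) (ω : Ω) : ℝ≥0∞ :=
  ∑' v, (N v ω : ℝ≥0∞)

/-- The generalized Poisson probability mass function with parameters `l` and `θ`. For `x = 0` the
exponent `x - 1` is the integer `-1`. -/
noncomputable def genPoissonPMFReal (l θ : ℝ) (x : ℕ) : ℝ :=
  l * (l + x * θ) ^ ((x : ℤ) - 1) / (x.factorial : ℝ) * Real.exp (-l - x * θ)

/-- The measure on `ℕ` with mass `genPoissonPMFReal l θ x` at `x`. -/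
noncomputable def genPoissonMeasure (l θ : ℝ) : Measure ℕ :=
  Measure.sum fun x : ℕ => ENNReal.ofReal (genPoissonPMFReal l θ x) • Measure.dirac x

/-!
Under the splash condition the innovations outside the root vanish and every thinning probability
equals `α ^ 2`. The family `N` is therefore a branching process: the root carries a Poisson(`λ_r`)
number of particles, and each particle has, independently, one child with probability `α ^ 2` along
each edge that leads away from the root, that is, along `χ` edges at the root and `χ - 1` edges
elsewhere. Averaging over the levels of the tree one after the other
(`IsPoissonTreeConstruction.lintegral_pow_levelCount`) gives, for `0 < s < 1`,
`E[s ^ M] = exp (λ_r (s (1 - α ^ 2 (1 - h)) ^ χ - 1))` with `h = s (1 - α ^ 2 (1 - h)) ^ (χ - 1)`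
(`IsMPMRF.tsum_measureReal_totalCount`). Since `χ α ^ 2 → θ` and `α → 0`, the fixed point `h` tends
to the solution `η ∈ [0, 1]` of `η = s exp (θ (η - 1))`: the limiting map is a contraction because
`θ < 1` (`tendsto_fixedPoint`). Hence `E[s ^ M] → exp (λ_r (η - 1))`.

This limit is the generating function of the generalized Poisson distribution. Writing
`s = η exp (θ (1 - η))`, it amounts to
`∑ x, λ (λ + x θ) ^ (x - 1) / x! * (η exp (-θ η)) ^ x = exp (λ η)` (`hasSum_abelCoeff`). For small
`η` this follows by expanding the exponentials: the coefficient of `η ^ n` in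
`∑ x, λ (λ + x θ) ^ (x - 1) / x! * η ^ x * exp (-(λ + x θ) η)` is a multiple of the `n`-th finite
difference of a polynomial of degree `n - 1`, hence zero for `n ≥ 1`. Both sides are analytic on
`(0, 1 / θ)`, so the identity extends to `η ∈ (0, 1]`; at `η = 1` it says that the masses add up to
`1`.

Convergence of generating functions implies convergence of the masses
(`tendsto_of_tendsto_tsum_mul_pow`), and since the limit has total mass `1`, also weak convergence
(`ProbabilityMeasure.tendsto_of_tendsto_singleton`).
-/

/-! ### The generating function of the generalized Poisson distribution -/

/-- The coefficients `l (l + x θ) ^ (x - 1) / x!` of the power series `∑ x, c x * z ^ x`, which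
takes the value `exp (l * η)` at `z = η * exp (-θ * η)`. -/
noncomputable def abelCoeff (l θ : ℝ) (x : ℕ) : ℝ :=
  l * (l + x * θ) ^ ((x : ℤ) - 1) / (x.factorial : ℝ)

lemma abelCoeff_nonneg {l θ : ℝ} (hl : 0 < l) (hθ : 0 ≤ θ) (x : ℕ) : 0 ≤ abelCoeff l θ x := by
  unfold abelCoeff
  positivity

lemma abelCoeff_zero {l : ℝ} (hl : 0 < l) (θ : ℝ) : abelCoeff l θ 0 = 1 := by
  simp [abelCoeff, hl.ne']

/-- Since `y ^ x / x! ≤ t ^ (-x) * exp (t * y)` for every `t > 0`, the coefficients grow at most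
geometrically; the choice `t = 1 / θ` gives the sharp rate `θ * exp 1`. -/
lemma abelCoeff_le {l θ t : ℝ} (hl : 0 < l) (hθ : 0 ≤ θ) (ht : 0 < t) (x : ℕ) :
    abelCoeff l θ x ≤ Real.exp (t * l) * (Real.exp (t * θ) / t) ^ x := by
  have hy : 0 < l + x * θ := by positivity
  have h1 : l * (l + x * θ) ^ ((x : ℤ) - 1) ≤ (l + x * θ) ^ x := by
    calc l * (l + x * θ) ^ ((x : ℤ) - 1) ≤ (l + x * θ) * (l + x * θ) ^ ((x : ℤ) - 1) := by
          gcongr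
          have : 0 ≤ (x : ℝ) * θ := by positivity
          linarith
      _ = (l + x * θ) ^ x := by
          rw [← zpow_one_add₀ hy.ne', ← zpow_natCast]
          congr 1
          ring
  have h2 := Real.pow_div_factorial_le_exp (t * (l + x * θ)) (by positivity) x
  calc abelCoeff l θ x ≤ (l + x * θ) ^ x / (x.factorial : ℝ) := by
        unfold abelCoeff; gcongr
    _ = (t * (l + x * θ)) ^ x / (x.factorial : ℝ) / t ^ x := by
        rw [mul_pow]; field_simp
    _ ≤ Real.exp (t * (l + x * θ)) / t ^ x := by gcongr
    _ = _ := by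
        rw [div_pow, ← Real.exp_nat_mul, mul_div_assoc', ← Real.exp_add]
        congr 2; ring

lemma sum_alternating_choose_mul_pow_eq_zero (l θ : ℝ) (n : ℕ) :
    ∑ k ∈ Finset.range (n + 2), (-1) ^ (n + 1 - k) * ((n + 1).choose k : ℝ) * (l + k * θ) ^ n
      = 0 := by
  have h := Polynomial.fwdDiff_iter_eq_zero_of_degree_lt (R := ℝ) (n := n + 1)
    (P := (Polynomial.C l + Polynomial.C θ * Polynomial.X) ^ n) (by
      refine Nat.lt_succ_of_le ((Polynomial.natDegree_pow_le_of_le n (m := 1) ?_).trans (by simp))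
      compute_degree)
  have h0 := congrFun h 0
  rw [fwdDiff_iter_eq_sum_shift] at h0
  rw [Pi.zero_apply] at h0
  rw [← h0]
  refine Finset.sum_congr rfl fun k _ => ?_
  simp [zsmul_eq_mul]
  left
  ring

/-- The antidiagonal sums of the double series obtained by expanding the exponential in
`∑ x, c x * η ^ x * exp (-(l + x * θ) * η)`: for `n ≥ 1`, the `n`-th one is a multiple of an `n`-th
finite difference of a polynomial of degree `n - 1`. -/
lemma sum_antidiagonal_abelCoeff {l : ℝ} (hl : 0 < l) {θ : ℝ} (hθ : 0 ≤ θ) (η : ℝ) (n : ℕ) :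
    ∑ k ∈ Finset.HasAntidiagonal.antidiagonal n, abelCoeff l θ k.1 * η ^ k.1 *
      ((-(l + k.1 * θ) * η) ^ k.2 / (k.2.factorial : ℝ)) = if n = 0 then 1 else 0 := by
  rcases n with _ | n
  · simp [abelCoeff_zero hl]
  rw [if_neg n.succ_ne_zero, Finset.Nat.sum_antidiagonal_eq_sum_range_succ_mk]
  rw [← mul_zero (l * η ^ (n + 1) / ((n + 1).factorial : ℝ)),
    ← sum_alternating_choose_mul_pow_eq_zero l θ n, Finset.mul_sum]
  refine Finset.sum_congr rfl fun k hk => ?_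
  have hk : k ≤ n + 1 := Nat.lt_succ_iff.1 (Finset.mem_range.1 hk)
  have hy : 0 < l + k * θ := by positivity
  obtain ⟨m, hm⟩ := Nat.exists_eq_add_of_le hk
  have hm' : n + 1 - k = m := by omega
  have hpow : (l + k * θ) ^ ((k : ℤ) - 1) * (l + k * θ) ^ m = (l + k * θ) ^ n := by
    rw [← zpow_natCast, ← zpow_natCast, ← zpow_add₀ hy.ne']
    congr 1
    have : (n : ℤ) + 1 = k + m := by exact_mod_cast hm
    omega
  simp only [hm']
  rw [Nat.cast_choose ℝ hk, hm', abelCoeff, ← hpow, neg_mul, neg_pow, mul_pow, hm, pow_add]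
  have := Nat.factorial_ne_zero (k + m)
  field_simp

/-- For small `η` the expansion of the exponential gives an absolutely convergent double series,
which can be summed along antidiagonals. -/
lemma hasSum_abelCoeff_of_small {l θ η : ℝ} (hl : 0 < l) (hθ : θ ∈ Set.Ioo (0 : ℝ) 1)
    (hη : η ∈ Set.Ioo (0 : ℝ) (Real.exp (-2))) :
    HasSum (fun x => abelCoeff l θ x * (η * Real.exp (-(θ * η))) ^ x) (Real.exp (l * η)) := by
  obtain ⟨hθ0, hθ1⟩ := hθ
  obtain ⟨hη0, hη2⟩ := hη
  have hη1 : η < 1 := hη2.trans (by rw [Real.exp_lt_one_iff]; norm_num)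
  set g : ℕ × ℕ → ℝ := fun k => abelCoeff l θ k.1 * η ^ k.1 *
      ((-(l + k.1 * θ) * η) ^ k.2 / (k.2.factorial : ℝ)) with hg
  have hexp : ∀ y : ℝ, HasSum (fun m : ℕ => y ^ m / (m.factorial : ℝ)) (Real.exp y) := fun y => by
    rw [Real.exp_eq_exp_ℝ]; exact NormedSpace.expSeries_div_hasSum_exp y
  have hin : ∀ x : ℕ, HasSum (fun m => g (x, m))
      (abelCoeff l θ x * η ^ x * Real.exp (-(l + x * θ) * η)) := fun x => (hexp _).mul_left _
  have hnorm : ∀ x m : ℕ, ‖g (x, m)‖ = abelCoeff l θ x * η ^ x *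
      (((l + x * θ) * η) ^ m / (m.factorial : ℝ)) := fun x m => by
    have h1 := abelCoeff_nonneg hl hθ0.le x
    simp only [hg, neg_mul, norm_mul, norm_div, norm_pow, norm_neg, Real.norm_eq_abs]
    rw [abs_of_nonneg h1, abs_of_pos hη0, abs_of_pos (by positivity : 0 < l + x * θ)]
    simp
  have hinn : ∀ x : ℕ, HasSum (fun m => ‖g (x, m)‖)
      (abelCoeff l θ x * η ^ x * Real.exp ((l + x * θ) * η)) := fun x => by
    simp only [hnorm]
    exact (hexp _).mul_left _
  have hsum : Summable g := by
    refine Summable.of_norm ((summable_prod_of_nonneg fun _ => norm_nonneg _).2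
      ⟨fun x => (hinn x).summable, ?_⟩)
    simp only [(hinn _).tsum_eq]
    have hq : η * Real.exp 2 < 1 := by
      rwa [← lt_div_iff₀ (Real.exp_pos _), one_div, ← Real.exp_neg]
    refine Summable.of_nonneg_of_le (fun x => ?_) (fun x => ?_)
      ((summable_geometric_of_lt_one (by positivity) hq).mul_left
        (Real.exp l * Real.exp (l * η)))
    · have := abelCoeff_nonneg hl hθ0.le x
      positivity
    · have h1 := abelCoeff_le hl hθ0.le one_pos x
      simp only [one_mul, div_one] at h1
      have h2 : Real.exp θ * Real.exp (θ * η) ≤ Real.exp 2 := by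
        rw [← Real.exp_add]
        apply Real.exp_le_exp.2
        nlinarith
      calc abelCoeff l θ x * η ^ x * Real.exp ((l + x * θ) * η)
          ≤ (Real.exp l * Real.exp θ ^ x) * η ^ x * Real.exp ((l + x * θ) * η) := by gcongr
        _ = Real.exp l * Real.exp (l * η) *
              (η * (Real.exp θ * Real.exp (θ * η))) ^ x := by
            rw [show (l + x * θ) * η = l * η + x * (θ * η) by ring, Real.exp_add,
              Real.exp_nat_mul]
            ring
        _ ≤ _ := by gcongr
  have hdiag : ∑' k, g k = 1 := by
    have hsum' : Summable fun c => g (Finset.HasAntidiagonal.sigmaAntidiagonalEquivProd c) :=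
      (Finset.HasAntidiagonal.sigmaAntidiagonalEquivProd.summable_iff).2 hsum
    rw [← Finset.HasAntidiagonal.sigmaAntidiagonalEquivProd.tsum_eq,
      hsum'.tsum_sigma' (fun n => (hasSum_fintype _).summable)]
    rw [tsum_congr (g := fun n : ℕ => if n = 0 then (1 : ℝ) else 0)]
    · simp
    · intro n
      rw [tsum_fintype, ← sum_antidiagonal_abelCoeff hl hθ0.le η n]
      exact Finset.sum_attach (Finset.HasAntidiagonal.antidiagonal n) g
  have hprod : HasSum (fun x : ℕ => abelCoeff l θ x * η ^ x * Real.exp (-(l + x * θ) * η)) 1 := by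
    rw [← hdiag]
    exact hsum.hasSum.prod_fiberwise hin
  convert! hprod.mul_left (Real.exp (l * η)) using 1
  · funext x
    rw [show -(l + x * θ) * η = -(l * η) + x * (-(θ * η)) by ring, Real.exp_add,
      Real.exp_nat_mul, Real.exp_neg (l * η), mul_pow]
    have := Real.exp_pos (l * η)
    field_simp
  · rw [mul_one]

/-- The map `η ↦ η * exp (-θ * η)` attains its maximum `1 / (θ * exp 1)`, the radius of convergence,
only at `η = 1 / θ`. -/
lemma abs_mul_exp_neg_lt {θ η : ℝ} (hθ : 0 < θ) (hη : η ∈ Set.Ioo 0 (1 / θ)) :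
    |η * Real.exp (-(θ * η))| < 1 / (θ * Real.exp 1) := by
  obtain ⟨h0, h1⟩ := hη
  have hlt : θ * η < 1 := by rw [mul_comm]; exact (lt_div_iff₀ hθ).1 h1
  rw [abs_of_pos (by positivity), lt_div_iff₀ (by positivity)]
  have h2 := Real.add_one_lt_exp (x := θ * η - 1) (by linarith)
  have h3 : Real.exp (θ * η - 1) * (Real.exp (-(θ * η)) * Real.exp 1) = 1 := by
    rw [← Real.exp_add, ← Real.exp_add]; simp
  calc η * Real.exp (-(θ * η)) * (θ * Real.exp 1)
      = (θ * η - 1 + 1) * (Real.exp (-(θ * η)) * Real.exp 1) := by ring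
    _ < Real.exp (θ * η - 1) * (Real.exp (-(θ * η)) * Real.exp 1) := by gcongr
    _ = 1 := h3

lemma summable_abelCoeff {l θ z : ℝ} (hl : 0 < l) (hθ : 0 < θ) (hz : |z| < 1 / (θ * Real.exp 1)) :
    Summable fun x => abelCoeff l θ x * z ^ x := by
  have hq : θ * Real.exp 1 * |z| < 1 := by
    rwa [mul_comm, ← lt_div_iff₀ (by positivity)]
  refine Summable.of_norm_bounded (((summable_geometric_of_lt_one (by positivity) hq)).mul_left
    (Real.exp (1 / θ * l))) fun x => ?_
  rw [norm_mul, Real.norm_eq_abs, Real.norm_eq_abs, abs_of_nonneg (abelCoeff_nonneg hl hθ.le x),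
    abs_pow]
  calc abelCoeff l θ x * |z| ^ x
      ≤ (Real.exp (1 / θ * l) * (Real.exp (1 / θ * θ) / (1 / θ)) ^ x) * |z| ^ x := by
        gcongr
        exact abelCoeff_le hl hθ.le (by positivity) x
    _ = _ := by
        rw [one_div_mul_cancel hθ.ne', mul_assoc, ← mul_pow]
        congr 2
        field_simp

lemma analyticOnNhd_tsum_abelCoeff {l θ : ℝ} (hl : 0 < l) (hθ : 0 < θ) :
    AnalyticOnNhd ℝ (fun z : ℝ => ∑' x, abelCoeff l θ x * z ^ x)
      {z | |z| < 1 / (θ * Real.exp 1)} := by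
  set p := FormalMultilinearSeries.ofScalars ℝ (abelCoeff l θ) with hp
  have hrad : ENNReal.ofReal (1 / (θ * Real.exp 1)) ≤ p.radius := by
    refine p.le_radius_of_bound (r := (1 / (θ * Real.exp 1)).toNNReal) (Real.exp (1 / θ * l))
      fun x => ?_
    rw [hp, FormalMultilinearSeries.ofScalars_norm, Real.norm_eq_abs,
      abs_of_nonneg (abelCoeff_nonneg hl hθ.le x), Real.coe_toNNReal _ (by positivity)]
    have h := abelCoeff_le hl hθ.le (one_div_pos.2 hθ) x
    rw [one_div_mul_cancel hθ.ne'] at h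
    calc _ ≤ (Real.exp (1 / θ * l) * (Real.exp 1 / (1 / θ)) ^ x) * (1 / (θ * Real.exp 1)) ^ x := by
          gcongr
      _ = Real.exp (1 / θ * l) := by
          rw [mul_assoc, ← mul_pow]
          have : Real.exp 1 / (1 / θ) * (1 / (θ * Real.exp 1)) = 1 := by
            have := Real.exp_pos 1
            field_simp
          rw [this, one_pow, mul_one]
  have hpos : 0 < ENNReal.ofReal (1 / (θ * Real.exp 1)) := by
    rw [ENNReal.ofReal_pos]; positivity
  have h := (p.hasFPowerSeriesOnBall (hpos.trans_le hrad)).analyticOnNhd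
  have hs : p.sum = fun z : ℝ => ∑' x, abelCoeff l θ x * z ^ x := by
    funext z
    have := FormalMultilinearSeries.ofScalars_sum_eq (E := ℝ) (abelCoeff l θ) z
    simpa [FormalMultilinearSeries.ofScalarsSum] using this
  rw [hs] at h
  refine h.mono fun z hz => ?_
  rw [Metric.mem_eball, edist_zero_right]
  refine lt_of_lt_of_le ?_ hrad
  rw [← ofReal_norm, ENNReal.ofReal_lt_ofReal_iff (by positivity)]
  exact hz

/-- Both sides are analytic in `η` on `(0, 1 / θ)`, which contains `(0, 1]`, and they agree for
small `η > 0`. -/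
theorem hasSum_abelCoeff {l θ η : ℝ} (hl : 0 < l) (hθ : θ ∈ Set.Ioo (0 : ℝ) 1)
    (hη : η ∈ Set.Icc (0 : ℝ) 1) :
    HasSum (fun x => abelCoeff l θ x * (η * Real.exp (-(θ * η))) ^ x) (Real.exp (l * η)) := by
  rcases hη.1.eq_or_lt with rfl | hη0
  · simpa [abelCoeff_zero hl] using
      hasSum_single (f := fun x => abelCoeff l θ x * (0 : ℝ) ^ x) 0 (by intro x hx; simp [hx])
  have h1θ : 1 < 1 / θ := by rw [lt_div_iff₀ hθ.1]; linarith [hθ.2]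
  have hU : η ∈ Set.Ioo 0 (1 / θ) := ⟨hη0, hη.2.trans_lt h1θ⟩
  -- a base point inside the region where the identity is already known
  set z₀ := Real.exp (-2) / 2
  have hz₀ : 0 < z₀ := by positivity
  have hz₀' : z₀ < Real.exp (-2) := half_lt_self (Real.exp_pos _)
  have hexp2 : Real.exp (-2) < 1 := by rw [Real.exp_lt_one_iff]; norm_num
  have hzU : z₀ ∈ Set.Ioo 0 (1 / θ) := ⟨hz₀, by linarith⟩
  have hA : AnalyticOnNhd ℝ ((fun z : ℝ => ∑' x, abelCoeff l θ x * z ^ x) ∘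
      fun η => η * Real.exp (-(θ * η))) (Set.Ioo 0 (1 / θ)) := by
    refine (analyticOnNhd_tsum_abelCoeff hl hθ.1).comp ?_ fun y hy => abs_mul_exp_neg_lt hθ.1 hy
    intro y _
    fun_prop
  have hB : AnalyticOnNhd ℝ (fun η => Real.exp (l * η)) (Set.Ioo 0 (1 / θ)) := by
    intro y _
    fun_prop
  have heq := hA.eqOn_of_preconnected_of_eventuallyEq hB isPreconnected_Ioo hzU (by
    filter_upwards [Ioo_mem_nhds hz₀ hz₀'] with y hy
    exact (hasSum_abelCoeff_of_small hl hθ hy).tsum_eq)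
  have := heq hU
  simp only [Function.comp_apply] at this
  rw [← this]
  exact (summable_abelCoeff hl hθ.1 (abs_mul_exp_neg_lt hθ.1 hU)).hasSum

lemma genPoissonPMFReal_nonneg {l θ : ℝ} (hl : 0 < l) (hθ : 0 ≤ θ) (x : ℕ) :
    0 ≤ genPoissonPMFReal l θ x := by
  unfold genPoissonPMFReal
  positivity

/-- The probability generating function of the generalized Poisson distribution at
`s = η * exp (θ * (1 - η))` is `exp (l * (η - 1))`. -/
theorem hasSum_genPoissonPMFReal_mul_pow {l θ η : ℝ} (hl : 0 < l) (hθ : θ ∈ Set.Ioo (0 : ℝ) 1)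
    (hη : η ∈ Set.Icc (0 : ℝ) 1) :
    HasSum (fun x => genPoissonPMFReal l θ x * (η * Real.exp (θ * (1 - η))) ^ x)
      (Real.exp (l * (η - 1))) := by
  convert! (hasSum_abelCoeff hl hθ hη).mul_left (Real.exp (-l)) using 1
  · funext x
    rw [genPoissonPMFReal, abelCoeff, show -l - x * θ = -l + x * (-θ) by ring, Real.exp_add,
      Real.exp_nat_mul, show θ * (1 - η) = θ + -(θ * η) by ring, Real.exp_add, Real.exp_neg θ,
      mul_pow, mul_pow, mul_pow, inv_pow]
    have := Real.exp_pos θ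
    field_simp
  · rw [← Real.exp_add]
    congr 1
    ring

theorem hasSum_genPoissonPMFReal {l θ : ℝ} (hl : 0 < l) (hθ : θ ∈ Set.Ioo (0 : ℝ) 1) :
    HasSum (genPoissonPMFReal l θ) 1 := by
  simpa using hasSum_genPoissonPMFReal_mul_pow hl hθ (η := 1) (by simp)

theorem isProbabilityMeasure_genPoissonMeasure {l θ : ℝ} (hl : 0 < l)
    (hθ : θ ∈ Set.Ioo (0 : ℝ) 1) : IsProbabilityMeasure (genPoissonMeasure l θ) :=
  (hasSum_genPoissonPMFReal hl hθ).isProbabilityMeasure_sum_dirac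
    fun x => genPoissonPMFReal_nonneg hl hθ.1.le x

/-! ### From generating functions to masses, and from masses to weak convergence -/

lemma summable_mul_pow_of_mem_Icc {q : ℕ → ℝ} (hq : ∀ x, q x ∈ Set.Icc (0 : ℝ) 1) {s : ℝ}
    (hs : s ∈ Set.Ioo (0 : ℝ) 1) : Summable fun x => q x * s ^ x :=
  Summable.of_nonneg_of_le (fun x => mul_nonneg (hq x).1 (pow_nonneg hs.1.le x))
    (fun x => mul_le_of_le_one_left (pow_nonneg hs.1.le x) (hq x).2)
    (summable_geometric_of_lt_one hs.1.le hs.2)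

lemma tsum_mul_pow_eq_add {q : ℕ → ℝ} (hq : ∀ x, q x ∈ Set.Icc (0 : ℝ) 1) {s : ℝ}
    (hs : s ∈ Set.Ioo (0 : ℝ) 1) :
    ∑' x, q x * s ^ x = q 0 + s * ∑' x, q (x + 1) * s ^ x := by
  rw [(summable_mul_pow_of_mem_Icc hq hs).tsum_eq_zero_add, ← tsum_mul_left]
  simp only [pow_zero, mul_one, pow_succ]
  congr 1
  exact tsum_congr fun x => by ring

lemma abs_tsum_mul_pow_sub_le {q : ℕ → ℝ} (hq : ∀ x, q x ∈ Set.Icc (0 : ℝ) 1) {s : ℝ}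
    (hs : s ∈ Set.Ioo (0 : ℝ) 1) : |∑' x, q x * s ^ x - q 0| ≤ s / (1 - s) := by
  have hq' : ∀ x, q (x + 1) ∈ Set.Icc (0 : ℝ) 1 := fun x => hq _
  have h1 : 0 ≤ ∑' x, q (x + 1) * s ^ x :=
    tsum_nonneg fun x => mul_nonneg (hq' x).1 (pow_nonneg hs.1.le x)
  have h2 : ∑' x, q (x + 1) * s ^ x ≤ (1 - s)⁻¹ := by
    rw [← tsum_geometric_of_lt_one hs.1.le hs.2]
    exact (summable_mul_pow_of_mem_Icc hq' hs).tsum_le_tsum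
      (fun x => mul_le_of_le_one_left (pow_nonneg hs.1.le x) (hq' x).2)
      (summable_geometric_of_lt_one hs.1.le hs.2)
  rw [tsum_mul_pow_eq_add hq hs, add_sub_cancel_left, abs_of_nonneg (mul_nonneg hs.1.le h1),
    div_eq_mul_inv]
  exact mul_le_mul_of_nonneg_left h2 hs.1.le

lemma tendsto_apply_zero_of_tendsto_tsum_mul_pow {q : ℕ → ℕ → ℝ} {p : ℕ → ℝ}
    (hq : ∀ n x, q n x ∈ Set.Icc (0 : ℝ) 1) (hp : ∀ x, p x ∈ Set.Icc (0 : ℝ) 1)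
    (h : ∀ s ∈ Set.Ioo (0 : ℝ) 1,
      Tendsto (fun n => ∑' x, q n x * s ^ x) atTop (𝓝 (∑' x, p x * s ^ x))) :
    Tendsto (fun n => q n 0) atTop (𝓝 (p 0)) := by
  rw [Metric.tendsto_atTop]
  intro ε hε
  -- with this `s`, each of the two remainders `s / (1 - s)` is `ε / 4`
  set s := ε / (ε + 4) with hs_def
  have hs : s ∈ Set.Ioo (0 : ℝ) 1 := ⟨by positivity, by rw [div_lt_one (by positivity)]; linarith⟩
  have hs' : s / (1 - s) = ε / 4 := by
    rw [hs_def]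
    have : 1 - ε / (ε + 4) = 4 / (ε + 4) := by field_simp; ring
    rw [this]; field_simp
  obtain ⟨n₀, hn₀⟩ := Metric.tendsto_atTop.1 (h s hs) (ε / 2) (by positivity)
  refine ⟨n₀, fun n hn => ?_⟩
  have h0 := hn₀ n hn
  have h1 := abs_tsum_mul_pow_sub_le (hq n) hs
  have h2 := abs_tsum_mul_pow_sub_le hp hs
  rw [Real.dist_eq] at h0 ⊢
  rw [hs', abs_le] at h1 h2
  rw [abs_lt] at h0 ⊢
  constructor <;> linarith [h1.1, h1.2, h2.1, h2.2, h0.1, h0.2]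

/-- Continuity theorem for generating functions: pointwise convergence on `(0, 1)` implies
convergence of each coefficient. -/
theorem tendsto_of_tendsto_tsum_mul_pow {q : ℕ → ℕ → ℝ} {p : ℕ → ℝ}
    (hq : ∀ n x, q n x ∈ Set.Icc (0 : ℝ) 1) (hp : ∀ x, p x ∈ Set.Icc (0 : ℝ) 1)
    (h : ∀ s ∈ Set.Ioo (0 : ℝ) 1,
      Tendsto (fun n => ∑' x, q n x * s ^ x) atTop (𝓝 (∑' x, p x * s ^ x))) (k : ℕ) :
    Tendsto (fun n => q n k) atTop (𝓝 (p k)) := by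
  induction k generalizing q p with
  | zero => exact tendsto_apply_zero_of_tendsto_tsum_mul_pow hq hp h
  | succ k ih =>
    refine ih (q := fun n x => q n (x + 1)) (p := fun x => p (x + 1)) (fun n x => hq n _)
      (fun x => hp _) fun s hs => ?_
    have h0 := tendsto_apply_zero_of_tendsto_tsum_mul_pow hq hp h
    have h1 := ((h s hs).sub h0).const_mul s⁻¹
    simp only [tsum_mul_pow_eq_add (hq _) hs, tsum_mul_pow_eq_add hp hs, add_sub_cancel_left,
      inv_mul_cancel_left₀ hs.1.ne'] at h1
    exact h1

/-- If the masses at the points `f x` converge to those of a probability measure `ν` on `ℕ`, there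
is no loss of mass in the limit and the measures converge weakly to the image of `ν`. -/
theorem ProbabilityMeasure.tendsto_of_tendsto_singleton {E : Type*} [TopologicalSpace E]
    [MeasurableSpace E] [OpensMeasurableSpace E] [MeasurableSingletonClass E]
    {f : ℕ → E} (hf : Function.Injective f)
    {μs : ℕ → ProbabilityMeasure E} {μ : ProbabilityMeasure E} {ν : Measure ℕ}
    (hμ : (μ : Measure E) = ν.map f)
    (h : ∀ x, Tendsto (fun n => (μs n : Measure E) {f x}) atTop (𝓝 (ν {x}))) :
    Tendsto μs atTop (𝓝 μ) := by
  refine tendsto_of_forall_isOpen_le_liminf' fun U hU => ?_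
  rw [hμ, Measure.map_apply .of_discrete hU.measurableSet, ← Measure.tsum_indicator_apply_singleton
    ν _ MeasurableSet.of_discrete, ← lintegral_count]
  have hle : ∀ n, ∫⁻ x, (f ⁻¹' U).indicator (fun x => (μs n : Measure E) {f x}) x ∂Measure.count
      ≤ (μs n : Measure E) U := fun n => by
    rw [lintegral_count, ← tsum_subtype (f ⁻¹' U) fun x => (μs n : Measure E) {f x},
      ← measure_biUnion (Set.to_countable _)
        (fun x _ y _ hxy => by simpa [Function.onFun] using hf.ne hxy)
        (fun x _ => measurableSet_singleton _)]
    exact measure_mono (by simp)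
  calc ∫⁻ x, (f ⁻¹' U).indicator (fun x => ν {x}) x ∂Measure.count
      = ∫⁻ x, liminf (fun n => (f ⁻¹' U).indicator (fun x => (μs n : Measure E) {f x}) x) atTop
          ∂Measure.count := by
        refine lintegral_congr fun x => ?_
        by_cases hx : x ∈ f ⁻¹' U
        · simp only [Set.indicator_of_mem hx]
          exact (h x).liminf_eq.symm
        · simp [Set.indicator_of_notMem hx]
    _ ≤ liminf (fun n => ∫⁻ x, (f ⁻¹' U).indicator (fun x => (μs n : Measure E) {f x}) x
          ∂Measure.count) atTop := lintegral_liminf_le fun n => .of_discrete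
    _ ≤ _ := liminf_le_liminf (.of_forall hle)

/-! ### Convergence of the fixed points -/

lemma abs_exp_neg_sub_exp_neg_le {a b : ℝ} (ha : 0 ≤ a) (hb : 0 ≤ b) :
    |Real.exp (-a) - Real.exp (-b)| ≤ |a - b| := by
  wlog hab : a ≤ b generalizing a b
  · rw [abs_sub_comm, abs_sub_comm a]
    exact this hb ha (le_of_not_ge hab)
  have h1 : Real.exp (-b) ≤ Real.exp (-a) := Real.exp_le_exp.2 (by linarith)
  have h2 : Real.exp (-b) = Real.exp (-a) * Real.exp (a - b) := by
    rw [← Real.exp_add]; congr 1; ring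
  have h3 : a - b + 1 ≤ Real.exp (a - b) := Real.add_one_le_exp _
  have h4 : Real.exp (-a) ≤ 1 := Real.exp_le_one_iff.2 (by linarith)
  have h5 : Real.exp (a - b) ≤ 1 := Real.exp_le_one_iff.2 (by linarith)
  rw [abs_of_nonneg (by linarith), abs_sub_comm, abs_of_nonneg (by linarith), h2]
  nlinarith [Real.exp_pos (-a)]

lemma abs_one_sub_mul_pow_sub_exp_le {p y : ℝ} (hp : p ∈ Set.Icc (0 : ℝ) 1)
    (hy : y ∈ Set.Icc (0 : ℝ) 1) (m : ℕ) :
    |(1 - p * y) ^ m - Real.exp (-(m * p * y))| ≤ m * p * p := by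
  have hpy0 : 0 ≤ p * y := mul_nonneg hp.1 hy.1
  have hpyp : p * y ≤ p := mul_le_of_le_one_right hp.1 hy.2
  have hpy1 : p * y ≤ 1 := hpyp.trans hp.2
  have hexp : Real.exp (-(m * p * y)) = Real.exp (-(p * y)) ^ m := by
    rw [← Real.exp_nat_mul]; congr 1; ring
  have h1 := Real.abs_exp_sub_one_sub_id_le (x := -(p * y))
    (by rwa [abs_neg, abs_of_nonneg hpy0])
  have h2 : |1 - p * y - Real.exp (-(p * y))| ≤ p * p := by
    rw [abs_sub_comm]
    calc |Real.exp (-(p * y)) - (1 - p * y)| = |Real.exp (-(p * y)) - 1 - -(p * y)| := by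
          congr 1; ring
      _ ≤ (-(p * y)) ^ 2 := h1
      _ = (p * y) * (p * y) := by ring
      _ ≤ p * p := mul_le_mul hpyp hpyp hpy0 hp.1
  have h3 : max |1 - p * y| |Real.exp (-(p * y))| ≤ 1 := by
    rw [abs_of_nonneg (by linarith), abs_of_pos (Real.exp_pos _)]
    exact max_le (by linarith) (Real.exp_le_one_iff.2 (by linarith))
  rw [hexp]
  calc |(1 - p * y) ^ m - Real.exp (-(p * y)) ^ m|
      ≤ |1 - p * y - Real.exp (-(p * y))| * m *
          max |1 - p * y| |Real.exp (-(p * y))| ^ (m - 1) := abs_pow_sub_pow_le _ _ _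
    _ ≤ (p * p) * m * 1 := by
        have := hp.1
        gcongr
        exact pow_le_one₀ (le_max_of_le_left (abs_nonneg _)) h3
    _ = m * p * p := by ring

/-- A version of `(1 - p y) ^ m ≈ exp (-θ y)` that is uniform in `y ∈ [0, 1]`. -/
lemma tendsto_one_sub_mul_pow_sub_exp {m : ℕ → ℕ} {p y : ℕ → ℝ} {θ : ℝ} (hθ : 0 ≤ θ)
    (hp : ∀ n, p n ∈ Set.Icc (0 : ℝ) 1) (hy : ∀ n, y n ∈ Set.Icc (0 : ℝ) 1)
    (hp0 : Tendsto p atTop (𝓝 0)) (hmp : Tendsto (fun n => m n * p n) atTop (𝓝 θ)) :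
    Tendsto (fun n => (1 - p n * y n) ^ m n - Real.exp (-(θ * y n))) atTop (𝓝 0) := by
  have hlim : Tendsto (fun n => m n * p n * p n + |m n * p n - θ|) atTop (𝓝 0) := by
    simpa using (hmp.mul hp0).add (hmp.sub_const θ).abs
  refine squeeze_zero_norm (fun n => ?_) hlim
  rw [Real.norm_eq_abs]
  have h1 := abs_one_sub_mul_pow_sub_exp_le (hp n) (hy n) (m n)
  have h2 : |Real.exp (-(m n * p n * y n)) - Real.exp (-(θ * y n))| ≤ |m n * p n - θ| := by
    refine (abs_exp_neg_sub_exp_neg_le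
      (mul_nonneg (mul_nonneg (Nat.cast_nonneg _) (hp n).1) (hy n).1)
      (mul_nonneg hθ (hy n).1)).trans ?_
    rw [← sub_mul, abs_mul, abs_of_nonneg (hy n).1]
    exact mul_le_of_le_one_right (abs_nonneg _) (hy n).2
  calc _ = |((1 - p n * y n) ^ m n - Real.exp (-(m n * p n * y n))) +
        (Real.exp (-(m n * p n * y n)) - Real.exp (-(θ * y n)))| := by congr 1; ring
    _ ≤ _ := (abs_add_le _ _).trans (add_le_add h1 h2)

/-- The fixed points of `h ↦ s (1 - p + p h) ^ m` converge to that of `η ↦ s exp (-θ (1 - η))`,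
because the limiting map is a contraction with constant `θ < 1`. -/
lemma tendsto_fixedPoint {m : ℕ → ℕ} {p h : ℕ → ℝ} {θ s η : ℝ} (hθ : θ ∈ Set.Ioo (0 : ℝ) 1)
    (hs : s ∈ Set.Icc (0 : ℝ) 1)
    (hp : ∀ n, p n ∈ Set.Icc (0 : ℝ) 1) (hh : ∀ n, h n ∈ Set.Icc (0 : ℝ) 1)
    (hp0 : Tendsto p atTop (𝓝 0)) (hmp : Tendsto (fun n => m n * p n) atTop (𝓝 θ))
    (hfix : ∀ n, h n = s * (1 - p n * (1 - h n)) ^ m n)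
    (hη : η ∈ Set.Icc (0 : ℝ) 1) (hηs : η = s * Real.exp (-(θ * (1 - η)))) :
    Tendsto h atTop (𝓝 η) := by
  have hy : ∀ n, 1 - h n ∈ Set.Icc (0 : ℝ) 1 := fun n =>
    ⟨by linarith [(hh n).2], by linarith [(hh n).1]⟩
  have hd := (tendsto_one_sub_mul_pow_sub_exp hθ.1.le hp hy hp0 hmp).abs.div_const (1 - θ)
  rw [abs_zero, zero_div] at hd
  rw [tendsto_iff_dist_tendsto_zero]
  refine squeeze_zero (fun n => dist_nonneg) (fun n => ?_) hd
  rw [Real.dist_eq, le_div_iff₀ (by linarith [hθ.2])]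
  set d := (1 - p n * (1 - h n)) ^ m n - Real.exp (-(θ * (1 - h n)))
  set e := Real.exp (-(θ * (1 - h n))) - Real.exp (-(θ * (1 - η)))
  have he : |e| ≤ θ * |h n - η| := by
    refine (abs_exp_neg_sub_exp_neg_le (mul_nonneg hθ.1.le (hy n).1)
      (mul_nonneg hθ.1.le (by linarith [hη.2]))).trans_eq ?_
    rw [← mul_sub, abs_mul, abs_of_pos hθ.1, sub_sub_sub_cancel_left, abs_sub_comm]
  have heq : h n - η = s * (d + e) := by
    calc h n - η = s * (1 - p n * (1 - h n)) ^ m n - s * Real.exp (-(θ * (1 - η))) := by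
          rw [← hfix n, ← hηs]
      _ = _ := by simp only [d, e]; ring
  have : |h n - η| ≤ |d| + θ * |h n - η| := by
    calc |h n - η| = s * |d + e| := by rw [heq, abs_mul, abs_of_nonneg hs.1]
      _ ≤ |d + e| := mul_le_of_le_one_left (abs_nonneg _) hs.2
      _ ≤ |d| + |e| := abs_add_le _ _
      _ ≤ _ := by gcongr
  linarith

/-! ### Levels of the Bethe lattice -/

section Tree

variable {V : Type u} {G : SimpleGraph V} {r : V}

lemma exists_isParent (hG : G.IsTree) {v : V} (hv : v ≠ r) : ∃ p, IsParent G r p v := by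
  obtain ⟨w, hw⟩ := hG.connected.exists_walk_length_eq_dist v r
  cases w with
  | nil => exact absurd rfl hv
  | @cons _ p _ hadj q =>
    refine ⟨p, hadj.symm, ?_⟩
    have h1 := G.dist_le q
    rw [SimpleGraph.Walk.length_cons] at hw
    rw [SimpleGraph.dist_comm (u := r), SimpleGraph.dist_comm (u := r)]
    rcases hG.dist_eq_dist_add_one_of_adj r hadj with h | h
    · rwa [SimpleGraph.dist_comm (u := r), SimpleGraph.dist_comm (u := r)] at h
    · rw [SimpleGraph.dist_comm (u := r), SimpleGraph.dist_comm (u := r)] at h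
      omega

/-- Two parents of `v` give two shortest walks from `r` to `v`, which coincide in a tree. -/
lemma IsParent.unique (hG : G.IsTree) {p q v : V} (hp : IsParent G r p v)
    (hq : IsParent G r q v) : p = q := by
  obtain ⟨w, hw⟩ := hG.connected.exists_walk_length_eq_dist r p
  obtain ⟨w', hw'⟩ := hG.connected.exists_walk_length_eq_dist r q
  have h1 : (w.concat hp.1).IsPath := SimpleGraph.Walk.isPath_of_length_eq_dist _ (by
    rw [SimpleGraph.Walk.length_concat, hw, hp.2])
  have h2 : (w'.concat hq.1).IsPath := SimpleGraph.Walk.isPath_of_length_eq_dist _ (by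
    rw [SimpleGraph.Walk.length_concat, hw', hq.2])
  have h := (hG.existsUnique_path r v).unique h1 h2
  obtain ⟨h, -⟩ := SimpleGraph.Walk.concat_inj h
  exact h

lemma IsParent.ne_root {p v : V} (h : IsParent G r p v) : v ≠ r := by
  rintro rfl
  have := h.2
  simp at this

/-- A vertex `u` of a tree has its neighbours as children, except for its parent if `u` is not the
root. -/
lemma neighborSet_eq_insert_isParent (hG : G.IsTree) {p u : V} (hp : IsParent G r p u) :
    G.neighborSet u = insert p {v | IsParent G r u v} := by
  ext v
  simp only [SimpleGraph.mem_neighborSet, Set.mem_insert_iff, Set.mem_ofPred_eq]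
  constructor
  · intro h
    rcases hG.dist_eq_dist_add_one_of_adj r h with h' | h'
    · exact .inl (IsParent.unique hG ⟨h.symm, h'⟩ hp)
    · exact .inr ⟨h, h'⟩
  · rintro (rfl | h)
    exacts [hp.1.symm, h.1]

namespace IsBetheLattice

variable {χ : ℕ}

lemma finite_neighborSet (h : IsBetheLattice G χ) (v : V) : (G.neighborSet v).Finite :=
  Set.finite_of_ncard_ne_zero (by rw [h.ncard_neighborSet]; have := h.two_le; omega)

lemma ncard_children_root (h : IsBetheLattice G χ) : {v | IsParent G r r v}.ncard = χ := by
  rw [← h.ncard_neighborSet r]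
  congr 1
  ext v
  refine ⟨fun hv => hv.1, fun hv => ⟨hv, ?_⟩⟩
  rw [SimpleGraph.dist_self, SimpleGraph.dist_eq_one_iff_adj.2 hv]

lemma ncard_children (h : IsBetheLattice G χ) {u : V} (hu : u ≠ r) :
    {v | IsParent G r u v}.ncard = χ - 1 := by
  obtain ⟨p, hp⟩ := exists_isParent h.isTree hu
  have h1 := h.ncard_neighborSet u
  have hfin := h.finite_neighborSet u
  rw [neighborSet_eq_insert_isParent h.isTree hp] at h1 hfin
  rw [Set.ncard_insert_of_notMem _ (hfin.subset (Set.subset_insert _ _))] at h1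
  · omega
  · intro hp'
    have h2 := hp.2
    have h3 := hp'.2
    omega

lemma finite_level (h : IsBetheLattice G χ) (k : ℕ) : {v | G.dist r v = k}.Finite := by
  induction k with
  | zero =>
    refine (Set.finite_singleton r).subset fun v hv => ?_
    exact (h.isTree.connected.dist_eq_zero_iff.1 hv).symm
  | succ k ih =>
    refine (ih.biUnion fun u _ => h.finite_neighborSet u).subset fun v hv => ?_
    have hvr : v ≠ r := by rintro rfl; simp at hv
    obtain ⟨p, hp⟩ := exists_isParent h.isTree hvr
    have h2 := hp.2
    simp only [Set.mem_ofPred_eq] at hv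
    exact Set.mem_biUnion (x := p) (show G.dist r p = k by omega) hp.1

lemma countable (h : IsBetheLattice G χ) : Countable V := by
  have hV := h.isTree.connected.nonempty
  rw [← Set.countable_univ_iff]
  refine (Set.countable_iUnion fun k => (h.finite_level (r := hV.some) k).countable).mono
    fun v _ => ?_
  exact Set.mem_iUnion.2 ⟨_, rfl⟩

/-- The set of vertices at distance `k` from `r`. -/
noncomputable def level (h : IsBetheLattice G χ) (r : V) (k : ℕ) : Finset V :=
  (h.finite_level (r := r) k).toFinset

@[simp] lemma mem_level (h : IsBetheLattice G χ) {k : ℕ} {v : V} :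
    v ∈ h.level r k ↔ G.dist r v = k := by
  simp [level]

lemma level_zero (h : IsBetheLattice G χ) : h.level r 0 = {r} := by
  ext v
  rw [mem_level, Finset.mem_singleton, h.isTree.connected.dist_eq_zero_iff, eq_comm]

/-- Summing the value at the parent over one level counts each vertex of the previous level once for
each of its children. -/
lemma sum_level_succ_parent (h : IsBetheLattice G χ) {pa : V → V}
    (hpa : ∀ v, v ≠ r → IsParent G r (pa v) v) (f : V → ℕ) (k : ℕ) :
    ∑ v ∈ h.level r (k + 1), f (pa v) =
      (if k = 0 then χ else χ - 1) * ∑ u ∈ h.level r k, f u := by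
  classical
  have hne : ∀ v ∈ h.level r (k + 1), v ≠ r := by
    rintro v hv rfl
    simp at hv
  have hmaps : ∀ v ∈ h.level r (k + 1), pa v ∈ h.level r k := fun v hv => by
    have h1 := (hpa v (hne v hv)).2
    rw [mem_level] at hv ⊢
    omega
  rw [← Finset.sum_fiberwise_of_maps_to hmaps, Finset.mul_sum]
  refine Finset.sum_congr rfl fun u hu => ?_
  have hset : (({v ∈ h.level r (k + 1) | pa v = u} : Finset V) : Set V) =
      {v | IsParent G r u v} := by
    ext v
    simp only [Finset.coe_filter, Set.mem_ofPred_eq]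
    constructor
    · rintro ⟨hv, rfl⟩
      exact hpa v (hne v hv)
    · intro hv
      refine ⟨?_, (hpa v hv.ne_root).unique h.isTree hv⟩
      rw [mem_level] at hu ⊢
      rw [hv.2, hu]
  rw [Finset.sum_congr rfl (g := fun _ => f u) (fun v hv => by rw [(Finset.mem_filter.1 hv).2]),
    Finset.sum_const, smul_eq_mul, ← Set.ncard_coe_finset, hset]
  congr 1
  rw [mem_level] at hu
  split_ifs with hk
  · rw [hk, h.isTree.connected.dist_eq_zero_iff] at hu
    rw [← hu, h.ncard_children_root]
  · refine h.ncard_children ?_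
    rintro rfl
    simp at hu
    omega

end IsBetheLattice

end Tree

/-! ### The branching process on the Bethe lattice -/

lemma lintegral_pow_poissonMeasure (l : NNReal) {x : ℝ} (hx : 0 ≤ x) :
    ∫⁻ n, ENNReal.ofReal x ^ n ∂(poissonMeasure l) = ENNReal.ofReal (Real.exp (l * (x - 1))) := by
  have hexp : HasSum (fun n : ℕ => Real.exp (-l) * l ^ n / (n.factorial : ℝ) * x ^ n)
      (Real.exp (l * (x - 1))) := by
    have h : HasSum (fun n : ℕ => ((l : ℝ) * x) ^ n / (n.factorial : ℝ)) (Real.exp (l * x)) := by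
      rw [Real.exp_eq_exp_ℝ]; exact NormedSpace.expSeries_div_hasSum_exp _
    convert! h.mul_left (Real.exp (-l)) using 1
    · funext n; rw [mul_pow]; ring
    · rw [← Real.exp_add]; congr 1; ring
  rw [poissonMeasure, lintegral_sum_measure, ← hexp.tsum_eq,
    ENNReal.ofReal_tsum_of_nonneg (fun n => by positivity) hexp.summable]
  refine tsum_congr fun n => ?_
  rw [lintegral_smul_measure, lintegral_dirac, smul_eq_mul, ENNReal.ofReal_mul (by positivity),
    ENNReal.ofReal_pow hx]

lemma lintegral_pow_bernoulliMeasure (p : unitInterval) {x : ℝ} (hx : 0 ≤ x) :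
    ∫⁻ n, ENNReal.ofReal x ^ n ∂(bernoulliMeasure 1 0 p) =
      ENNReal.ofReal (1 - p * (1 - x)) := by
  rw [bernoulliMeasure_def, lintegral_add_measure, lintegral_smul_measure, lintegral_smul_measure,
    lintegral_dirac, lintegral_dirac, pow_one, pow_zero]
  have h1 : (1 : ℝ) - p * (1 - x) = p * x + (1 - p) := by ring
  have hp := p.2
  rw [h1, ENNReal.ofReal_add (mul_nonneg hp.1 hx) (by linarith [hp.2]), ENNReal.ofReal_mul hp.1]
  have h2 : (unitInterval.toNNReal p : ℝ≥0∞) = ENNReal.ofReal p :=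
    (ENNReal.ofReal_eq_coe_nnreal hp.1).symm
  have h3 : (unitInterval.toNNReal (unitInterval.symm p) : ℝ≥0∞) = ENNReal.ofReal (1 - p) :=
    (ENNReal.ofReal_eq_coe_nnreal (unitInterval.symm p).2.1).symm
  simp only [ENNReal.smul_def, smul_eq_mul, mul_one, h2, h3]

lemma measurable_binomialThinning {Ω : Type*} {m : MeasurableSpace Ω} {I : ℕ → Ω → ℕ}
    (hI : ∀ j, Measurable (I j)) {Y : Ω → ℕ} (hY : Measurable Y) :
    Measurable (binomialThinning I Y) := by
  have h : Measurable fun p : ℕ × Ω => ∑ j ∈ Finset.range p.1, I j p.2 :=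
    measurable_from_prod_countable_right fun y =>
      Finset.measurable_sum (Finset.range y) fun j _ => hI j
  exact h.comp (hY.prodMk measurable_id)

lemma lintegral_prod_range_pow {Ω : Type*} {mΩ : MeasurableSpace Ω} {P : Measure Ω}
    [IsProbabilityMeasure P] {J : ℕ → Ω → ℕ} (hJm : ∀ j, Measurable (J j)) (hJ : iIndepFun J P)
    {t c : ℝ≥0∞} (hc : ∀ j, ∫⁻ ω, t ^ J j ω ∂P = c) (y : ℕ) :
    ∫⁻ ω, t ^ ∑ j ∈ Finset.range y, J j ω ∂P = c ^ y := by
  have hm : Measurable fun n : ℕ => t ^ n := .of_discrete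
  have h := lintegral_prod_eq_prod_lintegral_of_indepFun (μ := P) (Finset.range y)
    (fun j ω => t ^ J j ω) (hJ.comp (fun _ n => t ^ n) fun _ => hm)
    (fun j => hm.comp (hJm j))
  simp only [← Finset.prod_pow_eq_pow_sum]
  rw [h, Finset.prod_congr rfl fun j _ => hc j, Finset.prod_const, Finset.card_range]

/-- Averaging over the Bernoulli variables of one vertex, which are independent of everything
else, replaces the factor `t ^ (θ ∘ Y)` by `c ^ Y`, where `c` is the generating function of a
single Bernoulli variable at `t`. -/
lemma lintegral_mul_pow_binomialThinning {Ω : Type*} {m₁ m₂ mΩ : MeasurableSpace Ω}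
    {P : Measure Ω} [IsProbabilityMeasure P] (h₁ : m₁ ≤ mΩ) (h₂ : m₂ ≤ mΩ) (hind : Indep m₁ m₂ P)
    {J : ℕ → Ω → ℕ} (hJm : ∀ j, Measurable[m₂] (J j)) (hJ : iIndepFun J P)
    {t c : ℝ≥0∞} (hc : ∀ j, ∫⁻ ω, t ^ J j ω ∂P = c)
    {X : Ω → ℝ≥0∞} (hX : Measurable[m₁] X) {Y : Ω → ℕ} (hY : Measurable[m₁] Y) :
    ∫⁻ ω, X ω * t ^ binomialThinning J Y ω ∂P = ∫⁻ ω, X ω * c ^ Y ω ∂P := by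
  have hset : ∀ y, MeasurableSet[m₁] {ω | Y ω = y} := fun y =>
    hY (measurableSet_singleton y)
  have hsplit : ∀ (F : ℕ → Ω → ℝ≥0∞) (ω : Ω),
      X ω * F (Y ω) ω = ∑' y, {ω | Y ω = y}.indicator X ω * F y ω := fun F ω => by
    rw [tsum_eq_single (Y ω)]
    · simp
    · intro y hy
      simp [Ne.symm hy]
  have hXy : ∀ y, Measurable[m₁] ({ω | Y ω = y}.indicator X) := fun y => hX.indicator (hset y)
  have hSy : ∀ y, Measurable[m₂] fun ω => t ^ ∑ j ∈ Finset.range y, J j ω := fun y =>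
    (Measurable.of_discrete (f := fun n : ℕ => t ^ n)).comp
      (Finset.measurable_sum _ fun j _ => hJm j)
  have hL := hsplit fun y ω => t ^ ∑ j ∈ Finset.range y, J j ω
  have hR := hsplit fun y _ => c ^ y
  simp only [binomialThinning]
  rw [lintegral_congr hL, lintegral_congr hR, lintegral_tsum, lintegral_tsum]
  · refine tsum_congr fun y => ?_
    rw [lintegral_mul_eq_lintegral_mul_lintegral_of_independent_measurableSpace h₁ h₂ hind
      (hXy y) (hSy y), lintegral_prod_range_pow (fun j => (hJm j).mono h₂ le_rfl) hJ hc,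
      lintegral_mul_const _ ((hXy y).mono h₁ le_rfl)]
  · exact fun y => (((hXy y).mono h₁ le_rfl).mul_const _).aemeasurable
  · exact fun y => (((hXy y).mono h₁ le_rfl).mul ((hSy y).mono h₂ le_rfl)).aemeasurable

section Construction

variable {V : Type u} {G : SimpleGraph V} {r : V} {lam : V → ℝ} {alpha : Sym2 V → ℝ}
  {Ω : Type*} {mΩ : MeasurableSpace Ω} {P : Measure Ω}
  {L : V → Ω → ℕ} {I : V → ℕ → Ω → ℕ} {N : V → Ω → ℕ}

/-- The `σ`-algebra generated by those innovations and Bernoulli variables whose index is in `S`. -/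
@[reducible]
def sourceSigma (L : V → Ω → ℕ) (I : V → ℕ → Ω → ℕ) (S : Set (V ⊕ V × ℕ)) : MeasurableSpace Ω :=
  ⨆ i ∈ S, MeasurableSpace.comap (Sum.elim L (fun p : V × ℕ => I p.1 p.2) i) ⊤

lemma sourceSigma_mono {S T : Set (V ⊕ V × ℕ)} (h : S ⊆ T) :
    sourceSigma L I S ≤ sourceSigma L I T :=
  biSup_mono h

lemma measurable_sourceSigma {S : Set (V ⊕ V × ℕ)} {i : V ⊕ V × ℕ} (hi : i ∈ S) :
    Measurable[sourceSigma L I S] (Sum.elim L (fun p : V × ℕ => I p.1 p.2) i) :=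
  (comap_measurable _).mono
    (le_biSup (fun i => MeasurableSpace.comap (Sum.elim L (fun p : V × ℕ => I p.1 p.2) i) ⊤) hi)
    le_rfl

/-- The vertex to which an innovation or a Bernoulli variable belongs. -/
def sourceVertex : V ⊕ V × ℕ → V := Sum.elim id Prod.fst

/-- The variables that belong to vertices at distance at most `k` from the root. -/
def sourcesUpTo (G : SimpleGraph V) (r : V) (k : ℕ) : Set (V ⊕ V × ℕ) :=
  {i | G.dist r (sourceVertex i) ≤ k}

/-- The number of particles at distance `k` from the root. -/
noncomputable def levelCount {χ : ℕ} (hB : IsBetheLattice G χ) (r : V) (N : V → Ω → ℕ) (k : ℕ)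
    (ω : Ω) : ℕ :=
  ∑ v ∈ hB.level r k, N v ω

namespace IsPoissonTreeConstruction

lemma sourceSigma_le (hC : IsPoissonTreeConstruction G r lam alpha P L I N)
    (S : Set (V ⊕ V × ℕ)) : sourceSigma L I S ≤ mΩ := by
  refine iSup₂_le fun i _ => ?_
  rcases i with v | ⟨v, j⟩
  · exact (hC.measurable_L v).comap_le
  · exact (hC.measurable_I v j).comap_le

lemma indep_sourceSigma (hC : IsPoissonTreeConstruction G r lam alpha P L I N)
    {S T : Set (V ⊕ V × ℕ)} (hST : Disjoint S T) :
    Indep (sourceSigma L I S) (sourceSigma L I T) P := by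
  refine indep_iSup_of_disjoint (fun i => ?_) hC.iIndepFun.iIndep hST
  rcases i with v | ⟨v, j⟩
  · exact (hC.measurable_L v).comap_le
  · exact (hC.measurable_I v j).comap_le

/-- `N u` is a function of the variables that belong to `u` and to vertices closer to the root. -/
lemma measurable_of_source (hG : G.IsTree) (hC : IsPoissonTreeConstruction G r lam alpha P L I N)
    {S : Set (V ⊕ V × ℕ)} (u : V)
    (hS : ∀ i, G.dist r (sourceVertex i) < G.dist r u ∨ sourceVertex i = u → i ∈ S) :
    Measurable[sourceSigma L I S] (N u) := by
  induction hk : G.dist r u generalizing u with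
  | zero =>
    obtain rfl := hG.connected.dist_eq_zero_iff.1 hk
    rw [show N r = L r from funext hC.eq_root]
    exact measurable_sourceSigma (i := .inl r) (hS _ (.inr rfl))
  | succ k ih =>
    have hur : u ≠ r := by rintro rfl; simp at hk
    obtain ⟨p, hp⟩ := exists_isParent hG hur
    have hpd := hp.2
    have hNp : Measurable[sourceSigma L I S] (N p) := by
      refine ih p (fun i hi => hS i (.inl ?_)) (by omega)
      rcases hi with hi | hi
      · omega
      · rw [hi]; omega
    rw [show N u = fun ω => binomialThinning (I u) (N p) ω + L u ω from
      funext (hC.eq_child p u hp)]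
    refine (measurable_binomialThinning (fun j => ?_) hNp).add ?_
    · exact measurable_sourceSigma (i := .inr (u, j)) (hS _ (.inr rfl))
    · exact measurable_sourceSigma (i := .inl u) (hS _ (.inr rfl))

lemma measurable_N (hG : G.IsTree) (hC : IsPoissonTreeConstruction G r lam alpha P L I N) (u : V) :
    Measurable (N u) :=
  (hC.measurable_of_source hG (S := Set.univ) u fun _ _ => Set.mem_univ _).mono
    (hC.sourceSigma_le _) le_rfl

variable {χ : ℕ}

lemma measurable_levelCount (hB : IsBetheLattice G χ)
    (hC : IsPoissonTreeConstruction G r lam alpha P L I N) {i k : ℕ} (hik : i ≤ k) :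
    Measurable[sourceSigma L I (sourcesUpTo G r k)] (levelCount hB r N i) := by
  refine Finset.measurable_sum _ fun v hv => hC.measurable_of_source hB.isTree _ fun j hj => ?_
  rw [hB.mem_level] at hv
  show G.dist r (sourceVertex j) ≤ k
  rcases hj with hj | hj
  · omega
  · rw [hj]; omega

variable [IsProbabilityMeasure P]

/-- Averaging over the Bernoulli variables of a set `T` of vertices at distance `k + 1` from the
root, one vertex at a time. -/
lemma lintegral_mul_prod_pow (hG : G.IsTree)
    (hC : IsPoissonTreeConstruction G r lam alpha P L I N) {pa : V → V}
    (hpa : ∀ v, v ≠ r → IsParent G r (pa v) v) (hL : ∀ v, v ≠ r → L v =ᵐ[P] 0) {t c : ℝ≥0∞}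
    (hc : ∀ v, v ≠ r → ∀ j, ∫⁻ ω, t ^ I v j ω ∂P = c) {k : ℕ} (T : Finset V)
    (hT : ∀ v ∈ T, G.dist r v = k + 1) {X : Ω → ℝ≥0∞}
    (hX : Measurable[sourceSigma L I (sourcesUpTo G r k)] X) :
    ∫⁻ ω, X ω * t ^ ∑ v ∈ T, N v ω ∂P = ∫⁻ ω, X ω * c ^ ∑ v ∈ T, N (pa v) ω ∂P := by
  classical
  induction T using Finset.induction_on generalizing X with
  | empty => simp
  | @insert v T hvT ih =>
    have hv : G.dist r v = k + 1 := hT v (Finset.mem_insert_self _ _)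
    have hvr : v ≠ r := by rintro rfl; simp at hv
    have hpow : ∀ a : ℝ≥0∞, Measurable fun n : ℕ => a ^ n := fun a => .of_discrete
    -- the Bernoulli variables of `v`
    set S₂ : Set (V ⊕ V × ℕ) := Set.range fun j => .inr (v, j) with hS₂
    have hsub : sourcesUpTo G r k ⊆ S₂ᶜ := by
      rintro i hi ⟨j, rfl⟩
      have : G.dist r v ≤ k := hi
      omega
    have hpad := (hpa v hvr).2
    have hpam : Measurable[sourceSigma L I (sourcesUpTo G r k)] (N (pa v)) := by
      refine hC.measurable_of_source hG _ fun i hi => ?_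
      show G.dist r (sourceVertex i) ≤ k
      rcases hi with hi | hi
      · omega
      · rw [hi]; omega
    have hTm : ∀ w ∈ T, Measurable[sourceSigma L I S₂ᶜ] (N w) := by
      intro w hw
      refine hC.measurable_of_source hG _ ?_
      rintro i hi ⟨j, rfl⟩
      have hwk := hT w (Finset.mem_insert_of_mem hw)
      rcases hi with hi | hi
      · have : G.dist r v < G.dist r w := hi
        omega
      · have : v = w := hi
        exact hvT (this ▸ hw)
    have hX' : Measurable[sourceSigma L I S₂ᶜ] fun ω => X ω * t ^ ∑ w ∈ T, N w ω :=
      (hX.mono (sourceSigma_mono hsub) le_rfl).mul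
        ((hpow t).comp (Finset.measurable_sum _ hTm))
    have hstep := lintegral_mul_pow_binomialThinning (P := P) (hC.sourceSigma_le _)
      (hC.sourceSigma_le _) (hC.indep_sourceSigma (disjoint_compl_left (a := S₂))) (J := I v)
      (fun j => measurable_sourceSigma (i := .inr (v, j)) ⟨j, rfl⟩)
      (hC.iIndepFun.precomp (g := fun j => Sum.inr (v, j)) fun a b h => by simpa using h)
      (hc v hvr) hX' (hpam.mono (sourceSigma_mono hsub) le_rfl)
    calc ∫⁻ ω, X ω * t ^ ∑ w ∈ insert v T, N w ω ∂P
        = ∫⁻ ω, X ω * t ^ (∑ w ∈ T, N w ω) * t ^ binomialThinning (I v) (N (pa v)) ω ∂P := by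
          refine lintegral_congr_ae ?_
          filter_upwards [hL v hvr] with ω hω
          rw [Finset.sum_insert hvT, hC.eq_child _ v (hpa v hvr), hω, Pi.zero_apply, add_zero,
            pow_add]
          ring
      _ = ∫⁻ ω, X ω * c ^ N (pa v) ω * t ^ (∑ w ∈ T, N w ω) ∂P := by
          rw [hstep]
          exact lintegral_congr fun ω => by ring
      _ = ∫⁻ ω, X ω * c ^ N (pa v) ω * c ^ (∑ w ∈ T, N (pa w) ω) ∂P :=
          ih (fun w hw => hT w (Finset.mem_insert_of_mem hw)) (hX.mul ((hpow c).comp hpam))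
      _ = _ := by
          refine lintegral_congr fun ω => ?_
          rw [Finset.sum_insert hvT, pow_add, mul_assoc]

/-- Averaging over a whole level: given the previous levels, each particle at distance `k` produces
its offspring independently along each of the edges leading away from the root. -/
lemma lintegral_mul_pow_levelCount_succ (hB : IsBetheLattice G χ)
    (hC : IsPoissonTreeConstruction G r lam alpha P L I N) (hL : ∀ v, v ≠ r → L v =ᵐ[P] 0)
    {t c : ℝ≥0∞} (hc : ∀ v, v ≠ r → ∀ j, ∫⁻ ω, t ^ I v j ω ∂P = c) {k : ℕ} {X : Ω → ℝ≥0∞}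
    (hX : Measurable[sourceSigma L I (sourcesUpTo G r k)] X) :
    ∫⁻ ω, X ω * t ^ levelCount hB r N (k + 1) ω ∂P =
      ∫⁻ ω, X ω * (c ^ (if k = 0 then χ else χ - 1)) ^ levelCount hB r N k ω ∂P := by
  have hex : ∀ v, ∃ p, v ≠ r → IsParent G r p v := fun v => by
    by_cases hv : v = r
    · exact ⟨r, fun h => absurd hv h⟩
    · obtain ⟨p, hp⟩ := exists_isParent hB.isTree hv
      exact ⟨p, fun _ => hp⟩
  choose pa hpa using hex
  simp only [levelCount]
  rw [hC.lintegral_mul_prod_pow hB.isTree hpa hL hc _ (fun v hv => hB.mem_level.1 hv) hX]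
  refine lintegral_congr fun ω => ?_
  rw [hB.sum_level_succ_parent hpa (fun v => N v ω) k, pow_mul]

end IsPoissonTreeConstruction

/-- The value at `s` of the generating function of the total progeny of a particle that may have one
child along each of `m` edges, each with probability `p`, when `x` is the value at `s` of the
generating function of the total progeny of a child. -/
noncomputable def progenyMap (s p : ℝ) (m : ℕ) (x : ℝ) : ℝ := s * (1 - p * (1 - x)) ^ m

lemma one_sub_mul_one_sub_mem_Icc {p x : ℝ} (hp : p ∈ Set.Icc (0 : ℝ) 1)
    (hx : x ∈ Set.Icc (0 : ℝ) 1) : 1 - p * (1 - x) ∈ Set.Icc (0 : ℝ) 1 := by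
  obtain ⟨hp0, hp1⟩ := hp
  obtain ⟨hx0, hx1⟩ := hx
  constructor <;> nlinarith

lemma progenyMap_mem_Icc {s p x : ℝ} (hs : s ∈ Set.Icc (0 : ℝ) 1) (hp : p ∈ Set.Icc (0 : ℝ) 1)
    (m : ℕ) (hx : x ∈ Set.Icc (0 : ℝ) 1) : progenyMap s p m x ∈ Set.Icc 0 s := by
  have h := one_sub_mul_one_sub_mem_Icc hp hx
  exact ⟨mul_nonneg hs.1 (pow_nonneg h.1 m),
    mul_le_of_le_one_right hs.1 (pow_le_one₀ h.1 h.2)⟩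

lemma progenyMap_mono {s p x y : ℝ} (hs : s ∈ Set.Icc (0 : ℝ) 1) (hp : p ∈ Set.Icc (0 : ℝ) 1)
    (m : ℕ) (hx : x ∈ Set.Icc (0 : ℝ) 1) (hxy : x ≤ y) :
    progenyMap s p m x ≤ progenyMap s p m y := by
  have h := one_sub_mul_one_sub_mem_Icc hp hx
  have hs0 := hs.1
  have hp0 := hp.1
  unfold progenyMap
  gcongr
  exact h.1

/-- The generating function of the total progeny up to generation `K` decreases to a fixed point. -/
lemma exists_tendsto_iterate_progenyMap {s p : ℝ} (hs : s ∈ Set.Icc (0 : ℝ) 1)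
    (hp : p ∈ Set.Icc (0 : ℝ) 1) (m : ℕ) :
    ∃ h ∈ Set.Icc (0 : ℝ) 1, h = progenyMap s p m h ∧
      Tendsto (fun K => (progenyMap s p m)^[K] s) atTop (𝓝 h) := by
  have hmem : ∀ K, (progenyMap s p m)^[K] s ∈ Set.Icc (0 : ℝ) 1 := fun K => by
    induction K with
    | zero => exact hs
    | succ K ih =>
      rw [Function.iterate_succ_apply']
      exact Set.Icc_subset_Icc_right hs.2 (progenyMap_mem_Icc hs hp m ih)
  have hanti : Antitone fun K => (progenyMap s p m)^[K] s := antitone_nat_of_succ_le fun K => by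
    induction K with
    | zero => exact (progenyMap_mem_Icc hs hp m hs).2
    | succ K ih =>
      have h1 := hmem (K + 1)
      simp only [Function.iterate_succ_apply'] at ih h1 ⊢
      exact progenyMap_mono hs hp m h1 ih
  have hlim := tendsto_atTop_ciInf hanti ⟨0, by rintro _ ⟨K, rfl⟩; exact (hmem K).1⟩
  refine ⟨_, isClosed_Icc.mem_of_tendsto hlim (.of_forall hmem), ?_, hlim⟩
  refine (isFixedPt_of_tendsto_iterate hlim ?_).symm
  unfold progenyMap
  fun_prop

namespace IsPoissonTreeConstruction

variable {χ : ℕ} [IsProbabilityMeasure P]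

/-- The joint generating function of the number of particles within distance `K` of the root and of
the number of particles at distance `K + 1`, obtained by peeling off the levels one by one. -/
lemma lintegral_pow_levelCount (hB : IsBetheLattice G χ)
    (hC : IsPoissonTreeConstruction G r lam alpha P L I N) (hr : 0 ≤ lam r)
    (hL : ∀ v, v ≠ r → L v =ᵐ[P] 0) {p : ℝ} (hp : p ∈ Set.Icc (0 : ℝ) 1)
    (hI : ∀ v, v ≠ r → ∀ j, ∀ x ∈ Set.Icc (0 : ℝ) 1,
      ∫⁻ ω, ENNReal.ofReal x ^ I v j ω ∂P = ENNReal.ofReal (1 - p * (1 - x)))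
    {s : ℝ} (hs : s ∈ Set.Icc (0 : ℝ) 1) (K : ℕ) {x : ℝ} (hx : x ∈ Set.Icc (0 : ℝ) 1) :
    ∫⁻ ω, ENNReal.ofReal s ^ (∑ k ∈ Finset.range (K + 1), levelCount hB r N k ω) *
        ENNReal.ofReal x ^ levelCount hB r N (K + 1) ω ∂P =
      ENNReal.ofReal (Real.exp (lam r *
        (progenyMap s p χ ((progenyMap s p (χ - 1))^[K] x) - 1))) := by
  have hpow : ∀ a : ℝ≥0∞, Measurable fun n : ℕ => a ^ n := fun a => .of_discrete
  have hcx := one_sub_mul_one_sub_mem_Icc hp hx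
  have hX : Measurable[sourceSigma L I (sourcesUpTo G r K)] fun ω =>
      ENNReal.ofReal s ^ (∑ k ∈ Finset.range (K + 1), levelCount hB r N k ω) :=
    (hpow _).comp (Finset.measurable_sum _ fun k hk =>
      hC.measurable_levelCount hB (Nat.lt_succ_iff.1 (Finset.mem_range.1 hk)))
  rw [hC.lintegral_mul_pow_levelCount_succ hB hL (fun v hv j => hI v hv j x hx) hX]
  have hmerge : ∀ ω (m : ℕ),
      ENNReal.ofReal s ^ (∑ k ∈ Finset.range (K + 1), levelCount hB r N k ω) *
        (ENNReal.ofReal (1 - p * (1 - x)) ^ m) ^ levelCount hB r N K ω =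
      ENNReal.ofReal s ^ (∑ k ∈ Finset.range K, levelCount hB r N k ω) *
        ENNReal.ofReal (progenyMap s p m x) ^ levelCount hB r N K ω := fun ω m => by
    rw [Finset.sum_range_succ, pow_add, mul_assoc, ← mul_pow, ← ENNReal.ofReal_pow hcx.1,
      ← ENNReal.ofReal_mul hs.1, progenyMap]
  simp only [hmerge]
  cases K with
  | zero =>
    simp only [Finset.range_zero, Finset.sum_empty, pow_zero, one_mul, if_true,
      Function.iterate_zero, id]
    have hN : ∀ ω, levelCount hB r N 0 ω = L r ω := fun ω => by
      rw [levelCount, hB.level_zero, Finset.sum_singleton, hC.eq_root]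
    simp only [hN]
    rw [hC.law_root.lintegral_comp (f := fun n => ENNReal.ofReal (progenyMap s p χ x) ^ n)
      (hpow _).aemeasurable,
      lintegral_pow_poissonMeasure _ (progenyMap_mem_Icc hs hp χ hx).1, Real.coe_toNNReal _ hr]
  | succ K =>
    rw [if_neg K.succ_ne_zero, hC.lintegral_pow_levelCount hB hr hL hp hI hs K
      (Set.Icc_subset_Icc_right hs.2 (progenyMap_mem_Icc hs hp _ hx)),
      Function.iterate_succ_apply]

end IsPoissonTreeConstruction

end Construction

/-! ### The total count and its limit -/

/-- If the natural numbers `S K` increase to `M ∈ [0, ∞]` and `t < 1`, then `t ^ S K` tends to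
`t ^ M`, read as `0` for `M = ∞`. -/
lemma tendsto_pow_of_monotone {S : ℕ → ℕ} (hS : Monotone S) {M : ℝ≥0∞}
    (hM : Tendsto (fun K => (S K : ℝ≥0∞)) atTop (𝓝 M)) {t : ℝ≥0∞} (ht : t < 1) :
    Tendsto (fun K => t ^ S K) atTop (𝓝 (∑' x : ℕ, {y : ℝ≥0∞ | y = x}.indicator 1 M * t ^ x)) := by
  rcases tendsto_atTop_of_monotone hS with h | ⟨l, h⟩
  · have hMtop : M = ⊤ := tendsto_nhds_unique hM (ENNReal.tendsto_nat_nhds_top.comp h)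
    have h0 : ∑' x : ℕ, {y : ℝ≥0∞ | y = x}.indicator 1 M * t ^ x = 0 := by
      rw [ENNReal.tsum_eq_zero]
      intro x
      rw [Set.indicator_of_notMem, zero_mul]
      simp [hMtop]
    rw [h0]
    exact (ENNReal.tendsto_pow_atTop_nhds_zero_of_lt_one ht).comp h
  · have hev : ∀ᶠ K in atTop, S K = l := by simpa using h
    have hMl : M = l := tendsto_nhds_unique hM
      (tendsto_const_nhds.congr' (hev.mono fun K hK => by simp only [hK]))
    have h0 : ∑' x : ℕ, {y : ℝ≥0∞ | y = x}.indicator 1 M * t ^ x = t ^ l := by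
      rw [tsum_eq_single l]
      · simp [hMl]
      · intro x hx
        rw [Set.indicator_of_notMem, zero_mul]
        simpa [hMl] using hx.symm
    rw [h0]
    exact tendsto_const_nhds.congr' (hev.mono fun K hK => by simp only [hK])

lemma measurable_totalCount {V : Type u} [Countable V] {Ω : Type*} [MeasurableSpace Ω]
    {N : V → Ω → ℕ} (hN : ∀ v, Measurable (N v)) : Measurable (totalCount N) :=
  Measurable.tsum fun v => (Measurable.of_discrete (f := fun n : ℕ => (n : ℝ≥0∞))).comp
    (hN v)

section

variable {V : Type u} {G : SimpleGraph V} {r : V} {lam : V → ℝ} {alpha : Sym2 V → ℝ}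
  {Ω : Type*} {mΩ : MeasurableSpace Ω} {P : Measure Ω}
  {L : V → Ω → ℕ} {I : V → ℕ → Ω → ℕ} {N : V → Ω → ℕ} {χ : ℕ}

/-- The counts on the balls around `r` increase to the total count. The index is shifted by two so
that the ball of radius `K + 1` matches the `K`-th iterate in
`IsPoissonTreeConstruction.lintegral_pow_levelCount`. -/
lemma tendsto_sum_levelCount (hB : IsBetheLattice G χ) (N : V → Ω → ℕ) (ω : Ω) :
    Tendsto (fun K => ((∑ k ∈ Finset.range (K + 2), levelCount hB r N k ω : ℕ) : ℝ≥0∞)) atTop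
      (𝓝 (totalCount N ω)) := by
  classical
  have hdisj : ∀ K, ((Finset.range K : Finset ℕ) : Set ℕ).PairwiseDisjoint (hB.level r) := by
    intro K i _ j _ hij
    rw [Function.onFun, Finset.disjoint_left]
    intro v hi hj
    rw [hB.mem_level] at hi hj
    exact hij (hi.symm.trans hj)
  have hball : ∀ K, ((∑ k ∈ Finset.range K, levelCount hB r N k ω : ℕ) : ℝ≥0∞) =
      ∑ v ∈ (Finset.range K).biUnion (hB.level r), (N v ω : ℝ≥0∞) := fun K => by
    rw [Finset.sum_biUnion (hdisj K)]
    simp [levelCount]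
  have hmono : Monotone fun K => (Finset.range K).biUnion (hB.level r) := fun K K' h =>
    Finset.biUnion_subset_biUnion_of_subset_left _ (Finset.range_mono h)
  have hlim := (ENNReal.summable (f := fun v => (N v ω : ℝ≥0∞))).hasSum.comp
    (tendsto_atTop_finset_of_monotone hmono fun v =>
      ⟨G.dist r v + 1, Finset.mem_biUnion.2 ⟨G.dist r v, by simp, by simp⟩⟩)
  simp only [hball]
  exact hlim.comp (tendsto_add_atTop_nat 2)

namespace IsPoissonTreeConstruction

/-- The generating function of the total count, in terms of the generating function `h` of the
number of descendants (itself included) of a particle outside the root. An event on which the total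
count is `∞` contributes nothing, since `s < 1`. -/
lemma tsum_measureReal_totalCount [IsProbabilityMeasure P] (hB : IsBetheLattice G χ)
    (hC : IsPoissonTreeConstruction G r lam alpha P L I N) (hr : 0 ≤ lam r)
    (hL : ∀ v, v ≠ r → L v =ᵐ[P] 0) {p : ℝ} (hp : p ∈ Set.Icc (0 : ℝ) 1)
    (hI : ∀ v, v ≠ r → ∀ j, ∀ x ∈ Set.Icc (0 : ℝ) 1,
      ∫⁻ ω, ENNReal.ofReal x ^ I v j ω ∂P = ENNReal.ofReal (1 - p * (1 - x)))
    {s : ℝ} (hs : s ∈ Set.Ioo (0 : ℝ) 1) :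
    ∃ h ∈ Set.Icc (0 : ℝ) 1, h = progenyMap s p (χ - 1) h ∧
      ∑' x : ℕ, P.real {ω | totalCount N ω = (x : ℝ≥0∞)} * s ^ x =
        Real.exp (lam r * (progenyMap s p χ h - 1)) := by
  have := hB.countable
  have hs' := Set.Ioo_subset_Icc_self hs
  obtain ⟨h, hh, hfix, hlim⟩ := exists_tendsto_iterate_progenyMap hs' hp (χ - 1)
  refine ⟨h, hh, hfix, ?_⟩
  have hNm := hC.measurable_N hB.isTree
  have hMm := measurable_totalCount hNm
  have ht1 : ENNReal.ofReal s < 1 := by rw [ENNReal.ofReal_lt_one]; exact hs.2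
  have hWm : ∀ k, Measurable (levelCount hB r N k) := fun k =>
    Finset.measurable_sum _ fun v _ => hNm v
  have hpgf : ∀ K, ∫⁻ ω, ENNReal.ofReal s ^ (∑ k ∈ Finset.range (K + 2), levelCount hB r N k ω) ∂P
      = ENNReal.ofReal (Real.exp (lam r *
        (progenyMap s p χ ((progenyMap s p (χ - 1))^[K] s) - 1))) := fun K => by
    rw [← hC.lintegral_pow_levelCount hB hr hL hp hI hs' K hs']
    refine lintegral_congr fun ω => ?_
    rw [Finset.sum_range_succ, pow_add]
  have hleft : Tendsto (fun K => ∫⁻ ω,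
      ENNReal.ofReal s ^ (∑ k ∈ Finset.range (K + 2), levelCount hB r N k ω) ∂P) atTop
      (𝓝 (∫⁻ ω, ∑' x : ℕ, {y : ℝ≥0∞ | y = x}.indicator 1 (totalCount N ω) *
        ENNReal.ofReal s ^ x ∂P)) := by
    refine tendsto_lintegral_of_dominated_convergence (fun _ => 1) (fun K => ?_) (fun K => ?_)
      (by simp) ?_
    · exact (Measurable.of_discrete (f := fun n : ℕ => ENNReal.ofReal s ^ n)).comp
        (Finset.measurable_sum _ fun k _ => hWm k)
    · exact .of_forall fun ω => pow_le_one₀ zero_le ht1.le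
    · refine .of_forall fun ω => tendsto_pow_of_monotone (fun K K' hK => ?_)
        (tendsto_sum_levelCount hB N ω) ht1
      exact Finset.sum_le_sum_of_subset (Finset.range_mono (by omega))
  have hset : ∀ x : ℕ, MeasurableSet {ω | totalCount N ω = (x : ℝ≥0∞)} := fun x =>
    hMm (measurableSet_singleton _)
  have hint : ∫⁻ ω, ∑' x : ℕ, {y : ℝ≥0∞ | y = x}.indicator 1 (totalCount N ω) *
      ENNReal.ofReal s ^ x ∂P =
      ∑' x : ℕ, ENNReal.ofReal (P.real {ω | totalCount N ω = (x : ℝ≥0∞)} * s ^ x) := by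
    have hind : ∀ x : ℕ, (fun ω => {y : ℝ≥0∞ | y = x}.indicator (1 : ℝ≥0∞ → ℝ≥0∞)
        (totalCount N ω)) = {ω | totalCount N ω = (x : ℝ≥0∞)}.indicator 1 := fun x => rfl
    rw [lintegral_tsum]
    · refine tsum_congr fun x => ?_
      have hm : Measurable fun ω => {y : ℝ≥0∞ | y = x}.indicator (1 : ℝ≥0∞ → ℝ≥0∞)
          (totalCount N ω) := by
        rw [hind]; exact measurable_one.indicator (hset x)
      rw [lintegral_mul_const _ hm, hind, lintegral_indicator_one (hset x),
        ENNReal.ofReal_mul measureReal_nonneg, ofReal_measureReal, ENNReal.ofReal_pow hs.1.le]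
    · intro x
      refine AEMeasurable.mul_const ?_ _
      rw [hind]
      exact (measurable_one.indicator (hset x)).aemeasurable
  have hright : Tendsto (fun K => ENNReal.ofReal (Real.exp (lam r *
      (progenyMap s p χ ((progenyMap s p (χ - 1))^[K] s) - 1)))) atTop
      (𝓝 (ENNReal.ofReal (Real.exp (lam r * (progenyMap s p χ h - 1))))) := by
    have hcont : Continuous fun x => ENNReal.ofReal (Real.exp (lam r *
        (progenyMap s p χ x - 1))) := by
      refine ENNReal.continuous_ofReal.comp ?_
      unfold progenyMap
      fun_prop
    exact (hcont.tendsto h).comp hlim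
  simp only [hpgf] at hleft
  have heq := tendsto_nhds_unique hleft hright
  have hsum : Summable fun x : ℕ => P.real {ω | totalCount N ω = (x : ℝ≥0∞)} * s ^ x :=
    summable_mul_pow_of_mem_Icc (fun x => ⟨measureReal_nonneg, measureReal_le_one⟩) hs
  rw [hint, ← ENNReal.ofReal_tsum_of_nonneg (fun x => by have := hs.1; positivity) hsum] at heq
  exact (ENNReal.ofReal_eq_ofReal_iff
    (tsum_nonneg fun x => by have := hs.1; positivity) (Real.exp_pos _).le).1 heq

/-- Under the splash condition the innovations vanish outside the root. -/
lemma innovation_ae_eq_zero (hG : G.IsTree) (hadm : Admissible G lam alpha)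
    (hsp : IsSplash G r lam alpha) (hC : IsPoissonTreeConstruction G r lam alpha P L I N) {v : V}
    (hv : v ≠ r) : L v =ᵐ[P] 0 := by
  obtain ⟨q, hq⟩ := exists_isParent hG hv
  have hlaw := hC.law_innovation q v hq
  have hlq := hadm.1 q
  have ha := (hadm.2 q v hq.1).1
  have h0 : lam v - alpha s(q, v) * √(lam q * lam v) = 0 := by
    rw [hsp q v hq, show lam q * (lam q * alpha s(q, v) ^ 2) = (lam q * alpha s(q, v)) ^ 2 by ring,
      Real.sqrt_sq (by positivity)]
    ring
  rw [h0] at hlaw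
  have h1 : P {ω | L v ω ≠ 0} = 0 := by
    rw [hlaw.measure_eq (p := fun n => n ≠ 0) .of_discrete, poissonMeasure,
      Measure.sum_apply _ .of_discrete, ENNReal.tsum_eq_zero]
    intro n
    rcases n with _ | n <;> simp
  exact h1

lemma lintegral_pow_thinning (hG : G.IsTree) (hadm : Admissible G lam alpha)
    (hsp : IsSplash G r lam alpha) (hC : IsPoissonTreeConstruction G r lam alpha P L I N) {a : ℝ}
    (ha : ∀ e ∈ G.edgeSet, alpha e = a) {v : V} (hv : v ≠ r) (j : ℕ) {x : ℝ} (hx : 0 ≤ x) :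
    ∫⁻ ω, ENNReal.ofReal x ^ I v j ω ∂P = ENNReal.ofReal (1 - a ^ 2 * (1 - x)) := by
  obtain ⟨q, hq⟩ := exists_isParent hG hv
  obtain ⟨θ, hθ, hlaw⟩ := hC.law_thinning q v hq j
  have hlq := hadm.1 q
  have hpos := (hadm.2 q v hq.1).1
  have hθ' : (θ : ℝ) = a ^ 2 := by
    rw [hθ, hsp q v hq, mul_div_cancel_left₀ _ hlq.ne', Real.sqrt_sq hpos.le,
      ha _ ((SimpleGraph.mem_edgeSet G).2 hq.1)]
    ring
  rw [hlaw.lintegral_comp (f := fun n => ENNReal.ofReal x ^ n) Measurable.of_discrete.aemeasurable,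
    lintegral_pow_bernoulliMeasure θ hx, hθ']

end IsPoissonTreeConstruction

lemma measurable_tsum_coe (V : Type u) [Countable V] :
    Measurable fun n : V → ℕ => ∑' v, (n v : ℝ≥0∞) :=
  measurable_totalCount (N := fun v (n : V → ℕ) => n v) fun v => measurable_pi_apply v

lemma IsMPMRF.aemeasurable_totalCount (hB : IsBetheLattice G χ)
    (hN : IsMPMRF G r lam alpha P N) : AEMeasurable (totalCount N) P := by
  obtain ⟨-, Ω', _, P', L', I', N', -, -, hid⟩ := hN
  have := hB.countable
  exact (measurable_tsum_coe V).comp_aemeasurable hid.aemeasurable_fst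

/-- The generating function of the total count for a constant dependence parameter `a` under the
splash condition. -/
theorem IsMPMRF.tsum_measureReal_totalCount (hB : IsBetheLattice G χ)
    (hN : IsMPMRF G r lam alpha P N) (hsp : IsSplash G r lam alpha) {a : ℝ}
    (ha : a ∈ Set.Ioc (0 : ℝ) 1) (halpha : ∀ e ∈ G.edgeSet, alpha e = a) {s : ℝ}
    (hs : s ∈ Set.Ioo (0 : ℝ) 1) :
    ∃ h ∈ Set.Icc (0 : ℝ) 1, h = progenyMap s (a ^ 2) (χ - 1) h ∧
      ∑' x : ℕ, P.real {ω | totalCount N ω = (x : ℝ≥0∞)} * s ^ x =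
        Real.exp (lam r * (progenyMap s (a ^ 2) χ h - 1)) := by
  obtain ⟨hadm, Ω', _, P', L', I', N', hP', hC, hid⟩ := hN
  have := hB.countable
  obtain ⟨h, hh, hfix, hsum⟩ := hC.tsum_measureReal_totalCount hB (hadm.1 r).le
    (fun v hv => hC.innovation_ae_eq_zero hB.isTree hadm hsp hv)
    (p := a ^ 2) ⟨sq_nonneg a, pow_le_one₀ ha.1.le ha.2⟩
    (fun v hv j x hx => hC.lintegral_pow_thinning hB.isTree hadm hsp halpha hv j hx.1) hs
  refine ⟨h, hh, hfix, ?_⟩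
  rw [← hsum]
  refine tsum_congr fun x => ?_
  have hM := hid.comp (measurable_tsum_coe V)
  congr 1
  exact congrArg ENNReal.toReal (hM.measure_mem_eq (measurableSet_singleton (x : ℝ≥0∞)))

end

/-- Every point of `[0, 1]` is of the form at which `hasSum_genPoissonPMFReal_mul_pow` gives the
generating function. -/
lemma exists_mul_exp_eq {θ s : ℝ} (hs : s ∈ Set.Icc (0 : ℝ) 1) :
    ∃ η ∈ Set.Icc (0 : ℝ) 1, η * Real.exp (θ * (1 - η)) = s := by
  have h := intermediate_value_Icc (zero_le_one' ℝ)
    (f := fun η => η * Real.exp (θ * (1 - η))) (by fun_prop)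
  simp only [zero_mul, sub_self, mul_zero, Real.exp_zero, mul_one] at h
  exact h hs

lemma genPoissonMeasure_singleton (l θ : ℝ) (x : ℕ) :
    genPoissonMeasure l θ {x} = ENNReal.ofReal (genPoissonPMFReal l θ x) := by
  rw [genPoissonMeasure, Measure.sum_smul_dirac_singleton]

theorem mainTheorem5
    (V : ℕ → Type u) (G : (n : ℕ) → SimpleGraph (V n)) (r : (n : ℕ) → V n)
    (χ : ℕ → ℕ) (hG : ∀ n, IsBetheLattice (G n) (χ n))
    (a : ℕ → ℝ) (ha : ∀ n, a n ∈ Set.Ioc (0 : ℝ) 1)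
    (alpha : (n : ℕ) → Sym2 (V n) → ℝ) (halpha : ∀ n, ∀ e ∈ (G n).edgeSet, alpha n e = a n)
    (lr : ℝ) (hlr : 0 < lr)
    (lam : (n : ℕ) → V n → ℝ) (hlam_root : ∀ n, lam n (r n) = lr)
    (hlam : ∀ n, IsSplash (G n) (r n) (lam n) (alpha n))
    (Ω : ℕ → Type*) [∀ n, MeasurableSpace (Ω n)]
    (P : (n : ℕ) → Measure (Ω n)) [∀ n, IsProbabilityMeasure (P n)]
    (N : (n : ℕ) → V n → Ω n → ℕ)
    (hN : ∀ n, IsMPMRF (G n) (r n) (lam n) (alpha n) (P n) (N n))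
    (θ : ℝ) (hθ : θ ∈ Set.Ioo (0 : ℝ) 1)
    (hχ : Tendsto χ atTop atTop)
    (hχa : Tendsto (fun n => (χ n : ℝ) * a n ^ 2) atTop (𝓝 θ)) :
    ∃ _ : IsProbabilityMeasure (genPoissonMeasure lr θ),
      TendstoInDistribution (fun n => totalCount (N n)) atTop
        (fun x : ℕ => (x : ℝ≥0∞)) P (genPoissonMeasure lr θ) ∧
      ∀ x : ℕ, Tendsto (fun n => (P n).real {ω | totalCount (N n) ω = (x : ℝ≥0∞)}) atTop
        (𝓝 (lr * (lr + x * θ) ^ ((x : ℤ) - 1) / (x.factorial : ℝ) * Real.exp (-lr - x * θ))) := by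
  have hprob := isProbabilityMeasure_genPoissonMeasure hlr hθ
  have hae : ∀ n, AEMeasurable (totalCount (N n)) (P n) := fun n =>
    (hN n).aemeasurable_totalCount (hG n)
  have hp : ∀ n, a n ^ 2 ∈ Set.Icc (0 : ℝ) 1 := fun n =>
    ⟨sq_nonneg _, pow_le_one₀ (ha n).1.le (ha n).2⟩
  have hχr : Tendsto (fun n => (χ n : ℝ)) atTop atTop := tendsto_natCast_atTop_atTop.comp hχ
  have hp0 : Tendsto (fun n => a n ^ 2) atTop (𝓝 0) := by
    refine (hχa.div_atTop hχr).congr fun n => ?_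
    have : (χ n : ℝ) ≠ 0 := by have := (hG n).two_le; positivity
    field_simp
  have hmp : Tendsto (fun n => ((χ n - 1 : ℕ) : ℝ) * a n ^ 2) atTop (𝓝 θ) := by
    have h := hχa.sub hp0
    rw [sub_zero] at h
    refine h.congr fun n => ?_
    rw [Nat.cast_sub (by have := (hG n).two_le; omega), Nat.cast_one]
    ring
  have hmass : ∀ x : ℕ, Tendsto (fun n => (P n).real {ω | totalCount (N n) ω = (x : ℝ≥0∞)}) atTop
      (𝓝 (genPoissonPMFReal lr θ x)) := by
    refine tendsto_of_tendsto_tsum_mul_pow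
      (q := fun n x => (P n).real {ω | totalCount (N n) ω = (x : ℝ≥0∞)})
      (fun n x => ⟨measureReal_nonneg, measureReal_le_one⟩) (fun x => ?_) fun s hs => ?_
    · exact ⟨genPoissonPMFReal_nonneg hlr hθ.1.le x,
        le_hasSum (hasSum_genPoissonPMFReal hlr hθ) x
          fun y _ => genPoissonPMFReal_nonneg hlr hθ.1.le y⟩
    have hs' := Set.Ioo_subset_Icc_self hs
    obtain ⟨η, hη, hηs⟩ := exists_mul_exp_eq (θ := θ) hs'
    have hηs' : η = s * Real.exp (-(θ * (1 - η))) := by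
      rw [← hηs, mul_assoc, ← Real.exp_add, add_neg_cancel, Real.exp_zero, mul_one]
    choose h hh hfix hsum using fun n =>
      (hN n).tsum_measureReal_totalCount (hG n) (hlam n) (ha n) (halpha n) hs
    have hlim := tendsto_fixedPoint hθ hs' hp hh hp0 hmp hfix hη hηs'
    -- the root has `χ n` children instead of `χ n - 1`, which does not matter in the limit
    have hroot : Tendsto (fun n => progenyMap s (a n ^ 2) (χ n) (h n)) atTop (𝓝 η) := by
      have h1 := tendsto_one_sub_mul_pow_sub_exp hθ.1.le hp (y := fun n => 1 - h n)
        (fun n => ⟨by linarith [(hh n).2], by linarith [(hh n).1]⟩) hp0 hχa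
      have h2 : Tendsto (fun n => Real.exp (-(θ * (1 - h n)))) atTop
          (𝓝 (Real.exp (-(θ * (1 - η))))) :=
        ((continuous_const.mul (continuous_const.sub continuous_id)).neg.rexp.tendsto η).comp hlim
      have h3 := (h1.add h2).const_mul s
      simp only [sub_add_cancel, zero_add, ← hηs'] at h3
      exact h3
    have hpgf := (hasSum_genPoissonPMFReal_mul_pow hlr hθ hη).tsum_eq
    rw [hηs] at hpgf
    simp only [hsum, hlam_root, hpgf]
    exact (Real.continuous_exp.tendsto _).comp ((hroot.sub_const 1).const_mul lr)
  refine ⟨hprob, ⟨hae, Measurable.of_discrete.aemeasurable, ?_⟩, hmass⟩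
  refine ProbabilityMeasure.tendsto_of_tendsto_singleton (f := fun x : ℕ => (x : ℝ≥0∞))
    (ν := genPoissonMeasure lr θ) Nat.cast_injective rfl fun x => ?_
  rw [genPoissonMeasure_singleton]
  refine (ENNReal.tendsto_ofReal (hmass x)).congr fun n => ?_
  rw [ofReal_measureReal]
  exact (Measure.map_apply_of_aemeasurable (hae n) (measurableSet_singleton _)).symm
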